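/- Let $\mathcal S=\{x_1+x_2 n:\ x_1,x_2\in\mathbb R\}$, $n^2=0$, be the algebra of dual numbers, $\mathcal S_c=\{z_1+z_2n:\ z_1,z_2\in\mathbb C\}$ its complexification, with conjugation $\overline{X+iY}=X-iY$ and imaginary part $\mathrm{Im}(X+iY)=Y$ for $X,Y\in\mathcal S$. Write $Z=z_1+z_2n$, $W=w_1+w_2n$ and let $$\mathcal Q=\{(Z,W)\in\mathcal S_c^2:\ \mathrm{Im}\,W=Z^2\bar Z^2\},$$ i.e. the surface $\mathrm{Im}\,w_1=|z_1|^4,\ \mathrm{Im}\,w_2=4\,\mathrm{Re}(z_1^2\bar z_1\bar z_2)$ in $\mathbb C^4$. Let $\mathrm{aut}\,\mathcal Q$ be the real vector space of germs at $0$ of vector fields $2\,\mathrm{Re}\,(f\,\partial/\partial Z+g\,\partial/\partial W)$, with $f,g$ holomorphic near $0$ in $\mathbb C^4$, that are tangent to $\mathcal Q$ near $0$, and let $\mathrm{aut}_{\mathcal S}\,\mathcal Q$ be the subspace of those for which $f,g$ are $\mathcal S$-holomorphic, i.e. sums near $0$ of convergent power series in $Z,W$ with coefficients in $\mathcal S_c$.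 Let $\mathrm{Aut}\,\mathcal Q=\exp(\mathrm{aut}\,\mathcal Q)$ be the local group of germs at $0$ of the time-one maps of these fields (where the flow exists near $0$ up to time one), and $\mathrm{Aut}_{\mathcal S}\,\mathcal Q$ the set of its $\mathcal S$-holomorphic elements. 1. $\mathrm{aut}\,\mathcal Q$ is finite-dimensional, $\dim_{\mathbb R}\mathrm{aut}\,\mathcal Q=\dim_{\mathbb R}\mathrm{aut}_{\mathcal S}\,\mathcal Q+1$, and $$\mathrm{aut}\,\mathcal Q=\mathrm{aut}_{\mathcal S}\,\mathcal Q\ \oplus\ \mathbb R\cdot 2\,\mathrm{Re}\Big(z_2\frac{\partial}{\partial z_2}+w_2\frac{\partial}{\partial w_2}\Big).$$ 2. The field $2\,\mathrm{Re}(z_2\,\partial/\partial z_2+w_2\,\partial/\partial w_2)$ generates the one-parameter group of holomorphic automorphisms of $\mathcal Q$ $$z_1\to z_1,\quad z_2\to e^tz_2,\quad w_1\to w_1,\quad w_2\to e^{t}w_2 .$$ 3. $\mathrm{Aut}_{\mathcal S}\,\mathcal Q=\exp(\mathrm{aut}_{\mathcal S}\,\mathcal Q)$. It contains the germs at $0$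 of all the maps $$G_{-4}:\ Z\to Z,\ W\to W+A\quad(A\in\mathcal S),$$ $$G_0:\ Z\to BZ,\ W\to B^2\bar B^2\,W\quad(B\in\mathcal S_c\ \text{invertible}),$$ $$G_4:\ Z\to Z\,(1-CW)^{-1/2},\ W\to W\,(1-CW)^{-1}\quad(C\in\mathcal S),$$ where $(1-CW)^{-1/2}$ is the sum of the binomial series, and an element of $\mathrm{Aut}\,\mathcal Q$ belongs to $\mathrm{Aut}_{\mathcal S}\,\mathcal Q$ if and only if it is the germ at $0$ of a composition of one map $G_4$, one map $G_0$ and one map $G_{-4}$ (applied in this order). -/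

import Mathlib

open Filter Topology

noncomputable section

namespace AlgCR

section General

variable {E F : Type*} [NormedAddCommGroup E] [NormedSpace ℂ E] [NormedSpace ℝ E]
  [NormedAddCommGroup F] [NormedSpace ℝ F]

/-- Infinitesimal holomorphic automorphisms of the real submanifold `{ρ = 0}` near the origin:
germs at `0` of real vector fields `2 Re (∑ fⱼ ∂/∂zⱼ)` with `f` holomorphic near `0`, tangent to
`{ρ = 0}`. The real field `2 Re (∑ fⱼ ∂/∂zⱼ)` acts on a real-differentiable function `u` at `p` by
the real derivative of `u` at `p` in the direction `f p`, so it is identified with the germ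
of `f`. -/
def aut (ρ : E → F) [IsScalarTower ℝ ℂ E] : Submodule ℝ (Germ (𝓝 (0 : E)) E) where
  carrier := {X | ∃ f : E → E, X = (f : Germ (𝓝 (0 : E)) E) ∧ AnalyticAt ℂ f 0 ∧
    ∀ᶠ p in 𝓝 (0 : E), ρ p = 0 → fderiv ℝ ρ p (f p) = 0}
  add_mem' := by
    rintro _ _ ⟨f, rfl, hf, hf'⟩ ⟨g, rfl, hg, hg'⟩
    refine ⟨f + g, rfl, hf.add hg, ?_⟩
    filter_upwards [hf', hg'] with p h1 h2 hp
    simp [h1 hp, h2 hp]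
  zero_mem' := by
    refine ⟨0, rfl, analyticAt_const, ?_⟩
    filter_upwards with p _
    simp
  smul_mem' := by
    rintro c _ ⟨f, rfl, hf, hf'⟩
    refine ⟨c • f, rfl, ?_, ?_⟩
    · have h : c • f = (c : ℂ) • f := by
        funext p
        simp only [Pi.smul_apply]
        rw [← one_smul ℂ (f p), ← smul_assoc, ← smul_assoc]
        simp
      rw [h]
      exact hf.const_smul
    · filter_upwards [hf'] with p h1 hp
      simp [h1 hp]

/-- `H` is the germ at `0` of the time-one map `exp X` of the flow of the holomorphic vector field
with germ `X`: for every `p` near `0` the integral curve of the field starting at `p` exists for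
`0 ≤ t ≤ 1` (inside a connected neighbourhood of `0` on which the field is holomorphic) and ends
at `H p`. -/
def IsExp (X H : Germ (𝓝 (0 : E)) E) : Prop :=
  ∃ (U : Set E) (f h : E → E), IsOpen U ∧ IsConnected U ∧ (0 : E) ∈ U ∧ AnalyticOnNhd ℂ f U ∧
    X = (f : Germ (𝓝 (0 : E)) E) ∧ H = (h : Germ (𝓝 (0 : E)) E) ∧
    ∀ᶠ p in 𝓝 (0 : E), ∃ γ : ℝ → E, γ 0 = p ∧ γ 1 = h p ∧
      ∀ t ∈ Set.Icc (0 : ℝ) 1,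
        γ t ∈ U ∧ HasDerivWithinAt γ (f (γ t)) (Set.Icc (0 : ℝ) 1) t

/-- The local group `exp (aut {ρ = 0})`, as a set of germs of maps at `0`. -/
def AutLoc (ρ : E → F) [IsScalarTower ℝ ℂ E] : Set (Germ (𝓝 (0 : E)) E) :=
  {H | ∃ X ∈ aut ρ, IsExp X H}

end General

/-- The algebra `S` of dual numbers `x₁ + x₂ n`, `n² = 0`, over the reals. -/
abbrev S := DualNumber ℝ

/-- The complexification of `S`, with elements `z₁ + z₂ n`; `z₁ = Z.fst`, `z₂ = Z.snd`. -/
abbrev Sc := DualNumber ℂ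

/-- The element `z₁ + z₂ n`. -/
def mkSc (z₁ z₂ : ℂ) : Sc := TrivSqZeroExt.inl z₁ + TrivSqZeroExt.inr z₂

/-- The inclusion of `S` in `Sc`. -/
def ofS (X : S) : Sc := mkSc X.fst X.snd

/-- The conjugation `X + iY ↦ X - iY` of `Sc`, where `X, Y` are in `S`. -/
def conjS (Z : Sc) : Sc := mkSc (star Z.fst) (star Z.snd)

/-- The imaginary part `Y` of `X + iY`, where `X, Y` are in `S`. -/
def imS (Z : Sc) : S := TrivSqZeroExt.inl Z.fst.im + TrivSqZeroExt.inr Z.snd.im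

/-- The defining function `Im W - Z² Z̄²`. -/
def rho (p : Sc × Sc) : Sc := ofS (imS p.2) - p.1 ^ 2 * conjS p.1 ^ 2

/-- The surface `Im W = Z² Z̄²`. -/
def Q : Set (Sc × Sc) := {p | rho p = 0}

/-- `u` is the sum near `0` of a power series in `Z, W` with coefficients in `Sc`. -/
def SHolFun (u : Sc × Sc → Sc) : Prop :=
  ∃ c : ℕ × ℕ → Sc, ∀ᶠ p in 𝓝 (0 : Sc × Sc),
    HasSum (fun j : ℕ × ℕ => c j * p.1 ^ j.1 * p.2 ^ j.2) (u p)

/-- Germs of `S`-holomorphic mappings of `Sc × Sc` to itself. -/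
def SHol (X : Germ (𝓝 (0 : Sc × Sc)) (Sc × Sc)) : Prop :=
  ∃ f : Sc × Sc → Sc × Sc, X = (f : Germ (𝓝 (0 : Sc × Sc)) (Sc × Sc)) ∧
    SHolFun (fun p => (f p).1) ∧ SHolFun (fun p => (f p).2)

lemma SHolFun.add {u v : Sc × Sc → Sc} (hu : SHolFun u) (hv : SHolFun v) :
    SHolFun (fun p => u p + v p) := by
  obtain ⟨c, hc⟩ := hu
  obtain ⟨d, hd⟩ := hv
  refine ⟨fun j => c j + d j, ?_⟩
  filter_upwards [hc, hd] with p h1 h2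
  simpa [add_mul] using h1.add h2

lemma SHolFun.smul {u : Sc × Sc → Sc} (r : ℝ) (hu : SHolFun u) :
    SHolFun (fun p => r • u p) := by
  obtain ⟨c, hc⟩ := hu
  refine ⟨fun j => r • c j, ?_⟩
  filter_upwards [hc] with p h1
  simpa [smul_mul_assoc] using h1.const_smul r

/-- The `S`-holomorphic fields in `aut Q`. -/
def autS : Submodule ℝ (Germ (𝓝 (0 : Sc × Sc)) (Sc × Sc)) where
  carrier := {X | X ∈ aut rho ∧ SHol X}
  add_mem' := by
    rintro _ _ ⟨h1, f, rfl, hf, hf'⟩ ⟨h2, g, rfl, hg, hg'⟩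
    exact ⟨add_mem h1 h2, f + g, rfl, hf.add hg, hf'.add hg'⟩
  zero_mem' := by
    refine ⟨zero_mem _, 0, rfl, ⟨0, ?_⟩, ⟨0, ?_⟩⟩ <;>
    · filter_upwards with p
      simp
  smul_mem' := by
    rintro r _ ⟨h1, f, rfl, hf, hf'⟩
    exact ⟨(aut rho).smul_mem r h1, r • f, rfl, hf.smul r, hf'.smul r⟩

/-- The `S`-holomorphic elements of the local group of `Q`. -/
def AutSLoc : Set (Germ (𝓝 (0 : Sc × Sc)) (Sc × Sc)) := {H | H ∈ AutLoc rho ∧ SHol H}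

/-- The field `2 Re (z₂ ∂/∂z₂ + w₂ ∂/∂w₂)`. -/
def X0 (p : Sc × Sc) : Sc × Sc := (mkSc 0 p.1.snd, mkSc 0 p.2.snd)

/-- The map `z₁ ↦ z₁, z₂ ↦ eᵗ z₂, w₁ ↦ w₁, w₂ ↦ eᵗ w₂`. -/
def flow (t : ℝ) (p : Sc × Sc) : Sc × Sc :=
  (mkSc p.1.fst (Complex.exp t * p.1.snd), mkSc p.2.fst (Complex.exp t * p.2.snd))

/-- `Z ↦ Z, W ↦ W + A`. -/
def GNeg (A : S) (p : Sc × Sc) : Sc × Sc := (p.1, p.2 + ofS A)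

/-- `Z ↦ B Z, W ↦ B² B̄² W`. -/
def GZero (B : Sc) (p : Sc × Sc) : Sc × Sc := (B * p.1, B ^ 2 * conjS B ^ 2 * p.2)

/-- `Z ↦ Z (1 - C W)^(-1/2), W ↦ W (1 - C W)⁻¹`, the power `-1/2` being the sum of the
binomial series. -/
def GPos (C : S) (p : Sc × Sc) : Sc × Sc :=
  (p.1 * (binomialSeries Sc (-1 / 2 : ℂ)).sum (-(ofS C * p.2)), p.2 * (1 - ofS C * p.2)⁻¹)

/-- The germ at `0` of a map. -/
def germ (h : Sc × Sc → Sc × Sc) : Germ (𝓝 (0 : Sc × Sc)) (Sc × Sc) := h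

end AlgCR

end

open Filter Topology

noncomputable section

namespace AlgCR

/-! Let `f = (F, g)` be tangent to `Q`. Polarizing the tangency equation makes the conjugates of `z`
and `w` independent variables `ζ` and `ω`, subject to `w - ω = 2i z²ζ²`. Taking `ζ = 0` shows that
`g` depends on `w` alone and is real. Expanding to second order in `ζ` expresses `zF` through the
differential of `g`. This differential is only `ℂ`-linear, and its failure to be `Sc`-linear leaves
one extra term: `F = z a(w) + n z₂ q(w)`.

The resulting functional equation is solved without further differentiation. Replacing `(v, v)` by
`(v(1 + τn), v(1 - τn))` preserves `z²ζ²` and forces `q` to be a real constant `κ`, the coefficient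
of `X0`. Once `κ X0` is removed, `G w - G ω = 2 (w - ω)(a w + star (a (star ω)))`. Exchanging `w`
and `ω`, and then comparing three points, makes `a` affine and `G` quadratic (`exists_parameters`).
Hence `aut Q` consists of the fields `sField c + κ X0`.

An `S`-holomorphic function has matching derivatives along `1` and `n`. This excludes `X0` from
`autS`, and applied to the time-one map it gives `e^κ = 1`, so an `S`-holomorphic exponential comes
from `κ = 0` (`eq_zero_of_sHol`).

For `κ = 0` the curve of the origin solves a Riccati equation. Every nearby curve is obtained from
it by two quadratures, as a product of the three basic maps with parameters depending on time
(`hasDerivWithinAt_curve`). Uniqueness of integral curves identifies the time-one map with such a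
product. -/

/-! ### The star algebra of complex dual numbers -/

@[simp] lemma fst_mkSc (a b : ℂ) : (mkSc a b).fst = a := by simp [mkSc]
@[simp] lemma snd_mkSc (a b : ℂ) : (mkSc a b).snd = b := by simp [mkSc]

@[simp] lemma fst_ofS (X : S) : (ofS X).fst = X.fst := by simp [ofS]
@[simp] lemma snd_ofS (X : S) : (ofS X).snd = X.snd := by simp [ofS]
@[simp] lemma fst_conjS (Z : Sc) : (conjS Z).fst = star Z.fst := by simp [conjS]
@[simp] lemma snd_conjS (Z : Sc) : (conjS Z).snd = star Z.snd := by simp [conjS]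
@[simp] lemma fst_imS (Z : Sc) : (imS Z).fst = Z.fst.im := by simp [imS]
@[simp] lemma snd_imS (Z : Sc) : (imS Z).snd = Z.snd.im := by simp [imS]

lemma Sc.ext {Z W : Sc} (h₁ : Z.fst = W.fst) (h₂ : Z.snd = W.snd) : Z = W :=
  TrivSqZeroExt.ext h₁ h₂

@[simp] lemma mkSc_fst_snd (Z : Sc) : mkSc Z.fst Z.snd = Z := Sc.ext (by simp) (by simp)

lemma fst_mulSc (Z W : Sc) : (Z * W).fst = Z.fst * W.fst := TrivSqZeroExt.fst_mul _ _

lemma norm_Sc (Z : Sc) : ‖Z‖ = ‖Z.fst‖ + ‖Z.snd‖ := TrivSqZeroExt.norm_def Z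

lemma norm_fst_le (Z : Sc) : ‖Z.fst‖ ≤ ‖Z‖ := by
  rw [norm_Sc]; linarith [norm_nonneg Z.snd]

lemma norm_snd_le (Z : Sc) : ‖Z.snd‖ ≤ ‖Z‖ := by
  rw [norm_Sc]; linarith [norm_nonneg Z.fst]

/-- Conjugation makes `Sc` a star ring. -/
instance : StarRing Sc where
  star := conjS
  star_involutive Z := by apply Sc.ext <;> simp
  star_mul Z W := by apply Sc.ext <;> simp [mul_comm, add_comm]
  star_add Z W := by apply Sc.ext <;> simp

lemma star_eq_conjS (Z : Sc) : star Z = conjS Z := rfl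

@[simp] lemma fst_star (Z : Sc) : (star Z).fst = star Z.fst := fst_conjS Z
@[simp] lemma snd_star (Z : Sc) : (star Z).snd = star Z.snd := snd_conjS Z

instance : StarModule ℂ Sc where
  star_smul c Z := by apply Sc.ext <;> simp

lemma norm_star_Sc (Z : Sc) : ‖star Z‖ = ‖Z‖ := by simp [norm_Sc]

instance : NormedStarGroup Sc := ⟨fun Z => (norm_star_Sc Z).le⟩

instance : StarModule ℝ Sc where
  star_smul c Z := by apply Sc.ext <;> simp

/-- The imaginary unit of `Sc`. -/
def iS : Sc := mkSc Complex.I 0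

/-- The nilpotent element `n`. -/
def nS : Sc := mkSc 0 1

@[simp] lemma fst_iS : iS.fst = Complex.I := by simp [iS]
@[simp] lemma snd_iS : iS.snd = 0 := by simp [iS]
@[simp] lemma fst_nS : nS.fst = 0 := by simp [nS]
@[simp] lemma snd_nS : nS.snd = 1 := by simp [nS]

lemma iS_sq : iS ^ 2 = -1 := by
  rw [sq]; apply Sc.ext <;> simp

lemma nS_sq : nS ^ 2 = 0 := by
  rw [sq]; apply Sc.ext <;> simp

@[simp] lemma star_iS : star iS = -iS := by apply Sc.ext <;> simp
@[simp] lemma star_nS : star nS = nS := by apply Sc.ext <;> simp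

@[simp] lemma star_ofS (X : S) : star (ofS X) = ofS X := by apply Sc.ext <;> simp

lemma exists_ofS {Z : Sc} (h : star Z = Z) : ∃ X : S, ofS X = Z := by
  have h1 : star Z.fst = Z.fst := by rw [← fst_star, h]
  have h2 : star Z.snd = Z.snd := by rw [← snd_star, h]
  refine ⟨TrivSqZeroExt.inl Z.fst.re + TrivSqZeroExt.inr Z.snd.re, ?_⟩
  apply Sc.ext
  · simpa using (Complex.conj_eq_iff_re.1 h1)
  · simpa using (Complex.conj_eq_iff_re.1 h2)

lemma ofS_imS (Z : Sc) : 2 * iS * ofS (imS Z) = Z - star Z := by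
  apply Sc.ext <;> apply Complex.ext <;> simp [two_mul, add_mul]

/-! ### The defining function and its differential -/

/-- `Z ↦ Im Z` as a continuous real-linear map. -/
def imL : Sc →L[ℝ] Sc :=
  (-(1 / 2 : ℝ)) • ((ContinuousLinearMap.mul ℝ Sc iS).comp
    (ContinuousLinearMap.id ℝ Sc - ((starL' ℝ : Sc ≃L[ℝ] Sc) : Sc →L[ℝ] Sc)))

lemma imL_apply (Z : Sc) : imL Z = ofS (imS Z) := by
  apply Sc.ext <;> apply Complex.ext <;> simp [imL] <;> ring

lemma two_iS_mul_imL (Z : Sc) : 2 * iS * imL Z = Z - star Z := by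
  rw [imL_apply, ofS_imS]

lemma hasFDerivAt_rho (p : Sc × Sc) : ∃ L : Sc × Sc →L[ℝ] Sc, HasFDerivAt rho L p ∧
    ∀ v, L v = imL v.2 - (2 * p.1 * star p.1 ^ 2 * v.1 + 2 * p.1 ^ 2 * star p.1 * star v.1) := by
  have h1 : HasFDerivAt (fun p : Sc × Sc => p.1) (ContinuousLinearMap.fst ℝ Sc Sc) p :=
    hasFDerivAt_fst
  have h2 : HasFDerivAt (fun p : Sc × Sc => imL p.2)
      (imL.comp (ContinuousLinearMap.snd ℝ Sc Sc)) p :=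
    imL.hasFDerivAt.comp p hasFDerivAt_snd
  have h3 := ((h1.mul h1).mul (h1.star.mul h1.star))
  have h4 := h2.sub h3
  have h5 : rho = (fun p : Sc × Sc => imL p.2) - (((fun p : Sc × Sc => p.1) * fun p => p.1) *
      ((fun p => star p.1) * fun p => star p.1)) := by
    funext q
    simp only [rho, imL_apply, Pi.sub_apply, Pi.mul_apply, ← star_eq_conjS]
    ring
  refine ⟨_, by rw [h5]; exact h4, fun v => ?_⟩
  simp [smul_eq_mul]
  ring

lemma eq_zero_of_two_mul {Z : Sc} (h : 2 * Z = 0) : Z = 0 := by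
  have h' : (2 : ℂ) • Z = 0 := by rw [two_smul, ← two_mul, h]
  exact (smul_eq_zero.1 h').resolve_left two_ne_zero

/-- Multiplication by `2i` replaces the imaginary part by `W - star W`. The equation becomes
polynomial in the variables and their conjugates, which is the form that can be polarized. -/
lemma rho_eq_zero_iff (p : Sc × Sc) :
    rho p = 0 ↔ p.2 - star p.2 = 2 * iS * (p.1 ^ 2 * star p.1 ^ 2) := by
  have h : 2 * iS * rho p = p.2 - star p.2 - 2 * iS * (p.1 ^ 2 * star p.1 ^ 2) := by
    rw [rho, ← star_eq_conjS]
    linear_combination ofS_imS p.2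
  rw [← sub_eq_zero (a := p.2 - star p.2), ← h]
  constructor
  · intro h; rw [h, mul_zero]
  · intro h
    have := congrArg (fun Z => -iS * Z) h
    simp only [mul_zero] at this
    have h2 : (2 : Sc) * rho p = 0 := by linear_combination this + 2 * rho p * iS_sq
    exact eq_zero_of_two_mul h2

lemma fderiv_rho_eq_zero_iff (p v : Sc × Sc) :
    fderiv ℝ rho p v = 0 ↔ v.2 - star v.2 =
      4 * iS * (p.1 * star p.1 ^ 2 * v.1 + p.1 ^ 2 * star p.1 * star v.1) := by
  obtain ⟨L, hL, hv⟩ := hasFDerivAt_rho p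
  rw [hL.fderiv, hv]
  have e := two_iS_mul_imL v.2
  constructor
  · intro h
    linear_combination -e + 2 * iS * h
  · intro h
    have h2 : (2 : Sc) * (imL v.2 - (2 * p.1 * star p.1 ^ 2 * v.1
        + 2 * p.1 ^ 2 * star p.1 * star v.1)) = 0 := by
      linear_combination -iS * e - iS * h  - (2 * (2 * p.1 * star p.1 ^ 2 * v.1
        + 2 * p.1 ^ 2 * star p.1 * star v.1) - 2 * imL v.2) * iS_sq
    exact eq_zero_of_two_mul h2

/-! ### Polarization of the tangency equation -/

/-- A holomorphic function near `0` that vanishes on the fixed points of a conjugation vanishes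
near `0`. -/
lemma eq_zero_of_eq_zero_on_real {E : Type*} [NormedAddCommGroup E] [NormedSpace ℂ E]
    {F : Type*} [NormedAddCommGroup F] [NormedSpace ℂ F] [CompleteSpace F]
    {σ : E → E} (σadd : ∀ x y, σ (x + y) = σ x + σ y) (σsmul : ∀ (c : ℂ) x, σ (c • x) = star c • σ x)
    (σσ : ∀ x, σ (σ x) = x) (σnorm : ∀ x, ‖σ x‖ = ‖x‖)
    {Ψ : E → F} {r : ℝ} (hd : ∀ e, ‖e‖ < r → DifferentiableAt ℂ Ψ e)
    (h0 : ∀ e, ‖e‖ < r → σ e = e → Ψ e = 0) (e : E) (he : ‖e‖ < r / 3) : Ψ e = 0 := by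
  set v : E := (1 / 2 : ℂ) • (e + σ e) with hv
  set w : E := (-Complex.I / 2) • (e - σ e) with hw
  have hvn : ‖v‖ ≤ ‖e‖ := by
    rw [hv, norm_smul]
    have := norm_add_le e (σ e)
    rw [σnorm] at this
    norm_num; linarith
  have hwn : ‖w‖ ≤ ‖e‖ := by
    rw [hw, norm_smul]
    have := norm_sub_le e (σ e)
    rw [σnorm] at this
    norm_num; linarith
  have hvs : σ v = v := by
    rw [hv, σsmul, σadd, σσ, add_comm]; simp
  have hws : σ w = w := by
    have : σ (e - σ e) = -(e - σ e) := by
      have h1 : σ (-σ e) = -e := by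
        have := σsmul (-1) (σ e)
        rw [σσ] at this
        simpa using this
      rw [sub_eq_add_neg, σadd, h1]; abel
    rw [hw, σsmul, this, smul_neg, ← neg_smul]
    simp [neg_div]
  -- The bound `‖v‖ + 2‖w‖ ≤ 3‖e‖` accounts for the radius `r / 3`. The disc of radius 2 contains `l
  -- = i`, where `v + l w = e`.
  have hb : ∀ l : ℂ, l ∈ Metric.ball (0 : ℂ) 2 → ‖v + l • w‖ < r := by
    intro l hl
    have h1 := norm_add_le v (l • w)
    rw [norm_smul l w] at h1
    have h2 : ‖l‖ < 2 := by simpa using hl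
    have h3 : ‖l‖ * ‖w‖ ≤ 2 * ‖e‖ :=
      mul_le_mul h2.le hwn (norm_nonneg _) (by norm_num)
    linarith
  have hφ : DifferentiableOn ℂ (fun l : ℂ => Ψ (v + l • w)) (Metric.ball 0 2) := by
    intro l hl
    refine DifferentiableAt.differentiableWithinAt ?_
    exact (hd _ (hb l hl)).comp l (by fun_prop)
  have hz : ∃ᶠ l in 𝓝[≠] (0 : ℂ), (fun l : ℂ => Ψ (v + l • w)) l = 0 := by
    have ht : Tendsto (fun x : ℝ => (x : ℂ)) (𝓝[≠] 0) (𝓝[≠] 0) := by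
      refine tendsto_nhdsWithin_of_tendsto_nhds_of_eventually_within _ ?_ ?_
      · exact (Complex.continuous_ofReal.tendsto' 0 0 (by simp)).mono_left nhdsWithin_le_nhds
      · filter_upwards [self_mem_nhdsWithin] with x hx
        simpa using hx
    refine ht.frequently (Eventually.frequently ?_)
    have : ∀ᶠ x : ℝ in 𝓝 0, ‖(x : ℂ)‖ < 2 := by
      have : Continuous fun x : ℝ => ‖(x : ℂ)‖ := by fun_prop
      exact this.tendsto' 0 0 (by simp) |>.eventually_lt_const (by norm_num)
    filter_upwards [nhdsWithin_le_nhds this] with x hx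
    refine h0 _ (hb _ (by simpa using hx)) ?_
    rw [σadd, σsmul (x : ℂ) w, hvs, hws]
    simp
  have hI := (hφ.analyticOnNhd Metric.isOpen_ball).eqOn_zero_of_preconnected_of_frequently_eq_zero
    (convex_ball _ _).isPreconnected (Metric.mem_ball_self (by norm_num)) hz
    (show Complex.I ∈ Metric.ball (0 : ℂ) 2 by simp)
  have he' : v + Complex.I • w = e := by
    rw [hv, hw, smul_smul]
    have : Complex.I * (-Complex.I / 2) = 1 / 2 := by
      linear_combination (-1 / 2) * Complex.I_sq
    rw [this, ← smul_add, add_add_sub_cancel, ← two_smul ℂ e, smul_smul]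
    norm_num
  simpa [he'] using hI

/-- The complexified tangency equation. -/
lemma exists_polarized {f : Sc × Sc → Sc × Sc} (hf : AnalyticAt ℂ f 0)
    (ht : ∀ᶠ p in 𝓝 (0 : Sc × Sc), rho p = 0 → fderiv ℝ rho p (f p) = 0) :
    ∃ r > 0, (∀ p : Sc × Sc, ‖p‖ < r → DifferentiableAt ℂ f p) ∧
      ∀ z ζ w ω : Sc, ‖z‖ < r → ‖ζ‖ < r → ‖w‖ < r → ‖ω‖ < r →
        w - ω = 2 * iS * (z ^ 2 * ζ ^ 2) →
        (f (z, w)).2 - star (f (star ζ, star ω)).2 =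
          4 * iS * (z * ζ ^ 2 * (f (z, w)).1 + z ^ 2 * ζ * star (f (star ζ, star ω)).1) := by
  obtain ⟨r0, hr0, h0⟩ := Metric.eventually_nhds_iff_ball.1 (hf.eventually_analyticAt.and ht)
  simp only [mem_ball_zero_iff] at h0
  -- With `r1 ≤ 1` the quartic term is bounded by `‖z‖`, so `P` and `R` send the ball of radius `r1`
  -- into the ball of radius `2 r1 ≤ r0`.
  set r1 := min 1 (r0 / 2) with hr1
  have hr1p : 0 < r1 := by positivity
  have hr11 : r1 ≤ 1 := min_le_left _ _
  have hr12 : r1 ≤ r0 / 2 := min_le_right _ _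
  have hbd : ∀ z ζ : Sc, ‖z‖ < r1 → ‖ζ‖ < r1 → ‖iS * (z ^ 2 * ζ ^ 2)‖ ≤ ‖z‖ := by
    intro z ζ hz hζ
    have e1 : ‖iS‖ = 1 := by simp [norm_Sc]
    calc ‖iS * (z ^ 2 * ζ ^ 2)‖ ≤ ‖iS‖ * (‖z‖ ^ 2 * ‖ζ‖ ^ 2) :=
          (norm_mul_le _ _).trans (mul_le_mul_of_nonneg_left ((norm_mul_le _ _).trans
            (mul_le_mul (norm_pow_le _ _) (norm_pow_le _ _) (norm_nonneg _) (by positivity)))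
            (norm_nonneg _))
      _ = ‖z‖ * (‖z‖ * ‖ζ‖ ^ 2) := by rw [e1]; ring
      _ ≤ ‖z‖ * 1 := by
          refine mul_le_mul_of_nonneg_left ?_ (norm_nonneg _)
          exact mul_le_one₀ (hz.le.trans hr11) (by positivity)
            (pow_le_one₀ (norm_nonneg _) (hζ.le.trans hr11))
      _ = ‖z‖ := mul_one _
  -- In `e = (z, ζ, u)` the last entry is the midpoint of `w` and `ω`. The fixed points of `σ` have
  -- `ζ = star z` and `u` real; there `P e` and `star (R e)` are the same point of `Q`.
  let P : Sc × Sc × Sc → Sc × Sc := fun e => (e.1, e.2.2 + iS * (e.1 ^ 2 * e.2.1 ^ 2))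
  let R : Sc × Sc × Sc → Sc × Sc := fun e => (e.2.1, e.2.2 - iS * (e.1 ^ 2 * e.2.1 ^ 2))
  let σ : Sc × Sc × Sc → Sc × Sc × Sc := fun e => (star e.2.1, star e.1, star e.2.2)
  have hP : ∀ e, ‖e‖ < r1 → ‖P e‖ < r0 := by
    intro e he
    simp only [Prod.norm_def, max_lt_iff] at he
    have := hbd _ _ he.1 he.2.1
    have h2 := norm_add_le e.2.2 (iS * (e.1 ^ 2 * e.2.1 ^ 2))
    simp only [P, Prod.norm_def, max_lt_iff]
    constructor <;> linarith
  have hR : ∀ e, ‖e‖ < r1 → ‖star (R e)‖ < r0 := by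
    intro e he
    simp only [Prod.norm_def, max_lt_iff] at he
    have := hbd _ _ he.1 he.2.1
    have h2 := norm_sub_le e.2.2 (iS * (e.1 ^ 2 * e.2.1 ^ 2))
    simp only [R, Prod.norm_def, max_lt_iff, Prod.fst_star, Prod.snd_star, norm_star]
    constructor <;> linarith
  have hPd : Differentiable ℂ P := by
    have h1 : Differentiable ℂ fun e : Sc × Sc × Sc => iS * (e.1 ^ 2 * e.2.1 ^ 2) :=
      ((differentiable_fst.pow 2).mul (differentiable_snd.fst.pow 2)).const_mul iS
    exact differentiable_fst.prodMk (differentiable_snd.snd.add h1)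
  have hRd : Differentiable ℂ R := by
    have h1 : Differentiable ℂ fun e : Sc × Sc × Sc => iS * (e.1 ^ 2 * e.2.1 ^ 2) :=
      ((differentiable_fst.pow 2).mul (differentiable_snd.fst.pow 2)).const_mul iS
    exact differentiable_snd.fst.prodMk (differentiable_snd.snd.sub h1)
  let Ψ : Sc × Sc × Sc → Sc := fun e => (f (P e)).2 - (star (f (star (R e)))).2 -
    4 * iS * (e.1 * e.2.1 ^ 2 * (f (P e)).1 + e.1 ^ 2 * e.2.1 * (star (f (star (R e)))).1)
  have hΨ : ∀ e, ‖e‖ < r1 → DifferentiableAt ℂ Ψ e := by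
    intro e he
    have h1 : DifferentiableAt ℂ (fun e => f (P e)) e :=
      DifferentiableAt.comp e (h0 _ (hP e he)).1.differentiableAt hPd.differentiableAt
    have h2 : DifferentiableAt ℂ (fun e => star (f (star (R e)))) e := by
      have h3 : DifferentiableAt ℂ (star ∘ f ∘ star) (star (star (R e))) :=
        (h0 _ (hR e he)).1.differentiableAt.star_star
      rw [star_star] at h3
      exact DifferentiableAt.comp (g := star ∘ f ∘ star) e h3 hRd.differentiableAt
    have h4 : DifferentiableAt ℂ (fun e : Sc × Sc × Sc => e.1) e := differentiableAt_fst
    have h5 : DifferentiableAt ℂ (fun e : Sc × Sc × Sc => e.2.1) e := differentiableAt_snd.fst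
    exact (h1.snd.sub h2.snd).sub ((((h4.mul (h5.pow 2)).mul h1.fst).add
      (((h4.pow 2).mul h5).mul h2.fst)).const_mul (4 * iS))
  have hz : ∀ e, ‖e‖ < r1 → σ e = e → Ψ e = 0 := by
    intro e he hs
    obtain ⟨z, ζ, u⟩ := e
    simp only [σ, Prod.mk.injEq] at hs
    obtain ⟨h1, h2, h3⟩ := hs
    subst h2
    have h4 : star (R (z, star z, u)) = P (z, star z, u) := by
      apply Prod.ext
      · simp [P, R]
      · simp [P, R, star_pow, h3, mul_comm]
    have h5 := (h0 _ (hP _ he)).2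
    rw [rho_eq_zero_iff, fderiv_rho_eq_zero_iff] at h5
    have h6 := h5 (by simp [P, star_pow, h3]; ring)
    simp only [Ψ, h4, Prod.snd_star, Prod.fst_star]
    rw [h6]
    simp only [P]
    ring
  have key := eq_zero_of_eq_zero_on_real (σ := σ) (Ψ := Ψ)
    (fun x y => by simp [σ]) (fun c x => by simp [σ, star_smul])
    (fun x => by simp [σ]) (fun x => by
      simp only [σ, Prod.norm_def, norm_star]
      rw [max_left_comm]) hΨ hz
  -- The midpoint has norm at most `‖w‖ + ‖z‖`, which must stay below `r1 / 3`.
  refine ⟨r1 / 6, by positivity, fun p hp => (h0 p (by linarith)).1.differentiableAt, ?_⟩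
  intro z ζ w ω h1 h2 h3 h4 h
  have h5 := hbd z ζ (by linarith) (by linarith)
  have h6 := norm_sub_le w (iS * (z ^ 2 * ζ ^ 2))
  have h7 := key (z, ζ, w - iS * (z ^ 2 * ζ ^ 2)) (by
    simp only [Prod.norm_def, max_lt_iff]
    refine ⟨by linarith, by linarith, by linarith⟩)
  have h8 : P (z, ζ, w - iS * (z ^ 2 * ζ ^ 2)) = (z, w) := by simp [P]
  have h9 : star (R (z, ζ, w - iS * (z ^ 2 * ζ ^ 2))) = (star ζ, star ω) := by
    have : w - iS * (z ^ 2 * ζ ^ 2) - iS * (z ^ 2 * ζ ^ 2) = ω := by linear_combination h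
    simp only [R, this]
    rfl
  simp only [Ψ, h8, h9, Prod.snd_star, Prod.fst_star] at h7
  exact sub_eq_zero.1 h7

/-! ### Dependence of tangent fields on `z` -/

lemma eq_zero_of_smul_eq_zero_near {F : Type*} [NormedAddCommGroup F] [NormedSpace ℂ F]
    {ψ : ℂ → F} (hc : ContinuousAt ψ 0) (h : ∀ᶠ ε in 𝓝[≠] (0 : ℂ), ψ ε = 0) : ψ 0 = 0 := by
  have h1 : Tendsto ψ (𝓝[≠] 0) (𝓝 (ψ 0)) := hc.tendsto.mono_left nhdsWithin_le_nhds
  have h2 : Tendsto ψ (𝓝[≠] 0) (𝓝 0) :=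
    tendsto_const_nhds.congr' (h.mono fun _ h => h.symm)
  exact tendsto_nhds_unique h1 h2

lemma eq_zero_of_mul_eq_zero {v Z : Sc} (hv : v.fst ≠ 0) (h : v * Z = 0) : Z = 0 := by
  have := congrArg (fun x => v⁻¹ * x) h
  simpa [← mul_assoc, TrivSqZeroExt.inv_mul_cancel hv] using this

lemma two_I_smul (Z : Sc) : (2 * Complex.I) • Z = 2 * iS * Z := by
  apply Sc.ext <;> simp [two_mul, add_mul]

/-- The function `F 0` vanishes and `z F z` is given by second derivatives. -/
lemma first_order {F : Sc → Sc → Sc} {Fb g : Sc → Sc} {r : ℝ} (hr : 0 < r) {ω : Sc} (hω : ‖ω‖ < r)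
    (hF : ∀ z, ‖z‖ < r → ContinuousAt (F z) ω)
    (hFb : DifferentiableAt ℂ Fb 0) (hg : DifferentiableAt ℂ g ω)
    (h : ∀ z ζ w : Sc, ‖z‖ < r → ‖ζ‖ < r → ‖w‖ < r → w - ω = 2 * iS * (z ^ 2 * ζ ^ 2) →
      g w - g ω = 4 * iS * (z * ζ ^ 2 * F z w + z ^ 2 * ζ * Fb ζ)) :
    ∃ (L : Sc →L[ℂ] Sc) (D : Sc), ∀ z, ‖z‖ < r → 2 * (z * F z ω) = L (z ^ 2) - 2 * z ^ 2 * D := by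
  -- Substitution of `ζ = ε` and of the value `w = ω + 2i ε² z²` that the constraint then imposes.
  have hpt : ∀ z : Sc, ‖z‖ < r → ∀ᶠ ε in 𝓝 (0 : ℂ),
      g (ω + ε ^ 2 • (2 * iS * z ^ 2)) - g ω = 4 * iS * (ε ^ 2 • (z * F z
        (ω + ε ^ 2 • (2 * iS * z ^ 2))) + ε • (z ^ 2 * Fb (ε • 1))) := by
    intro z hz
    have c1 : ∀ᶠ ε in 𝓝 (0 : ℂ), ‖ε • (1 : Sc)‖ < r := by
      have : Continuous fun ε : ℂ => ‖ε • (1 : Sc)‖ := by fun_prop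
      exact (this.tendsto' 0 0 (by simp)).eventually_lt_const hr
    have c2 : ∀ᶠ ε in 𝓝 (0 : ℂ), ‖ω + ε ^ 2 • (2 * iS * z ^ 2)‖ < r := by
      have : Continuous fun ε : ℂ => ‖ω + ε ^ 2 • (2 * iS * z ^ 2)‖ := by fun_prop
      exact (this.tendsto' 0 ‖ω‖ (by simp)).eventually_lt_const hω
    filter_upwards [c1, c2] with ε h1 h2
    have h3 := h z (ε • 1) (ω + ε ^ 2 • (2 * iS * z ^ 2)) hz h1 h2 (by
      rw [smul_pow, one_pow, mul_smul_comm, mul_one, mul_smul_comm]; simp)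
    rw [h3]
    simp only [smul_pow, one_pow, mul_smul_comm, mul_one, smul_mul_assoc]
  have hcw : ∀ d : Sc, ContinuousAt (fun ε : ℂ => ω + ε ^ 2 • d) 0 := by
    intro d; fun_prop
  have hFc : ∀ z : Sc, ‖z‖ < r → ContinuousAt
      (fun ε : ℂ => F z (ω + ε ^ 2 • (2 * iS * z ^ 2))) 0 := by
    intro z hz
    refine ContinuousAt.comp (g := F z) ?_ (hcw _)
    simpa using hF z hz
  have hFbd : DifferentiableAt ℂ (fun ε : ℂ => Fb (ε • 1)) 0 := by
    refine DifferentiableAt.comp (g := Fb) 0 (by simpa using hFb) (by fun_prop)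
  have hgd : ∀ d : Sc, HasDerivAt (fun ε : ℂ => g (ω + ε • d)) (fderiv ℂ g ω d) 0 := by
    intro d
    have h1 : HasDerivAt (fun ε : ℂ => ω + ε • d) d 0 := by
      simpa using ((hasDerivAt_id (0 : ℂ)).smul_const d).const_add ω
    have h2 : HasFDerivAt g (fderiv ℂ g ω) (ω + (0 : ℂ) • d) := by simpa using hg.hasFDerivAt
    exact h2.comp_hasDerivAt 0 h1
  have hgs : ∀ d : Sc, ∃ s : ℂ → Sc, ContinuousAt s 0 ∧ s 0 = fderiv ℂ g ω d ∧
      ∀ ε, g (ω + ε ^ 2 • d) - g ω = ε ^ 2 • s ε := by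
    intro d
    refine ⟨fun ε => dslope (fun ε : ℂ => g (ω + ε • d)) 0 (ε ^ 2), ?_, ?_, ?_⟩
    · refine ContinuousAt.comp (g := dslope (fun ε : ℂ => g (ω + ε • d)) 0) ?_ (by fun_prop)
      simpa using continuousAt_dslope_same.2 (hgd d).differentiableAt
    · simp [dslope_same, (hgd d).deriv]
    · intro ε
      have := sub_smul_dslope (fun ε : ℂ => g (ω + ε • d)) 0 (ε ^ 2)
      simpa using this.symm
  -- Order `ε`: the increment of `g` is of order `ε²`, so only `z² Fb 0` survives. An invertible `z`
  -- is enough.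
  have hFb0 : Fb 0 = 0 := by
    set z : Sc := ((r / 2 : ℝ) : ℂ) • 1 with hz
    have hzn : ‖z‖ < r := by
      rw [hz, norm_smul, norm_one, Complex.norm_real, Real.norm_of_nonneg] <;> linarith
    obtain ⟨s, hs1, -, hs3⟩ := hgs (2 * iS * z ^ 2)
    have key := eq_zero_of_smul_eq_zero_near (ψ := fun ε : ℂ => ε • s ε - 4 * iS * (ε • (z * F z
        (ω + ε ^ 2 • (2 * iS * z ^ 2))) + z ^ 2 * Fb (ε • 1)))
      ((continuousAt_id.smul hs1).sub (continuousAt_const.mul ((continuousAt_id.smul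
        (continuousAt_const.mul (hFc z hzn))).add (continuousAt_const.mul hFbd.continuousAt)))) (by
      filter_upwards [nhdsWithin_le_nhds (hpt z hzn), self_mem_nhdsWithin] with ε h1 h2
      rw [hs3] at h1
      have : ε • (ε • s ε - 4 * iS * (ε • (z * F z
        (ω + ε ^ 2 • (2 * iS * z ^ 2))) + z ^ 2 * Fb (ε • 1))) = 0 := by
        rw [smul_sub, smul_smul, ← sq, h1]
        simp only [smul_add, mul_add, mul_smul_comm, smul_smul, ← sq, sub_self]
      exact (smul_eq_zero.1 this).resolve_left h2)
    simp only [zero_smul, zero_add, zero_sub, neg_eq_zero] at key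
    have hi : iS * (z ^ 2 * Fb 0) = 0 := by
      refine eq_zero_of_two_mul (eq_zero_of_two_mul ?_)
      linear_combination key
    have hz0 : z.fst ≠ 0 := by simp [hz, hr.ne']
    refine eq_zero_of_mul_eq_zero (v := iS * z ^ 2) (by simp [hz0]) ?_
    linear_combination hi
  refine ⟨fderiv ℂ g ω, deriv (fun ε : ℂ => Fb (ε • 1)) 0, fun z hz => ?_⟩
  obtain ⟨s, hs1, hs2, hs3⟩ := hgs (2 * iS * z ^ 2)
  have hsl : ∀ ε : ℂ, Fb (ε • 1) = ε • dslope (fun ε : ℂ => Fb (ε • 1)) 0 ε := by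
    intro ε
    have := sub_smul_dslope (fun ε : ℂ => Fb (ε • 1)) 0 ε
    simpa [hFb0] using this.symm
  -- Order `ε²`: the derivative of `g` along `2i z²` equals `4i (z F + z² D)`.
  have key := eq_zero_of_smul_eq_zero_near (ψ := fun ε : ℂ => s ε - 4 * iS * ((z * F z
        (ω + ε ^ 2 • (2 * iS * z ^ 2))) + z ^ 2 * dslope (fun ε : ℂ => Fb (ε • 1)) 0 ε))
    (hs1.sub (continuousAt_const.mul ((continuousAt_const.mul (hFc z hz)).add
      (continuousAt_const.mul (continuousAt_dslope_same.2 hFbd))))) (by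
      filter_upwards [nhdsWithin_le_nhds (hpt z hz), self_mem_nhdsWithin] with ε h1 h2
      rw [hs3, hsl ε] at h1
      have : ε ^ 2 • (s ε - 4 * iS * ((z * F z
        (ω + ε ^ 2 • (2 * iS * z ^ 2))) + z ^ 2 * dslope (fun ε : ℂ => Fb (ε • 1)) 0 ε)) = 0 := by
        rw [smul_sub, h1]
        simp only [smul_add, mul_add, mul_smul_comm, smul_smul, ← sq, sub_self]
      exact (smul_eq_zero.1 this).resolve_left (pow_ne_zero 2 h2))
  simp only [hs2, dslope_same, ne_eq, OfNat.ofNat_ne_zero, not_false_eq_true, zero_pow, zero_smul,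
    add_zero] at key
  rw [← two_I_smul, map_smul, two_I_smul] at key
  set D := deriv (fun ε : ℂ => Fb (ε • 1)) 0
  have h2 : (2 : Sc) * (2 * (z * F z ω) - (fderiv ℂ g ω (z ^ 2) - 2 * z ^ 2 * D)) = 0 := by
    linear_combination iS * key - (2 * fderiv ℂ g ω (z ^ 2) - 4 * (z * F z ω + z ^ 2 * D)) * iS_sq
  exact sub_eq_zero.1 (eq_zero_of_two_mul h2)

/-- Division by `z` is possible only where `z.fst ≠ 0`; the other points are reached by continuity
along `z + ε`. As `L` is merely `ℂ`-linear, `L n` need not equal `n L 1`, and `q` measures the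
difference. -/
lemma linear_of_mul_self {F : Sc → Sc} {r : ℝ} (hr : 0 < r)
    (hF : ∀ z, ‖z‖ < r → ContinuousAt F z) {L : Sc →L[ℂ] Sc} {D : Sc}
    (h : ∀ z, ‖z‖ < r → 2 * (z * F z) = L (z ^ 2) - 2 * z ^ 2 * D) :
    ∃ (a : Sc) (q : ℂ), ∀ z, ‖z‖ < r → F z = z * a + mkSc 0 (z.snd * q) := by
  have hL : ∀ Z : Sc, L Z = Z.fst • L 1 + Z.snd • L nS := by
    intro Z
    rw [← map_smul, ← map_smul, ← map_add]
    congr 1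
    apply Sc.ext <;> simp
  have h1 : ∀ z, ‖z‖ < r → 2 * (z.fst * (F z).fst) = z.fst ^ 2 * (L 1).fst
      + 2 * z.fst * z.snd * (L nS).fst - 2 * z.fst ^ 2 * D.fst := by
    intro z hz
    have := congrArg TrivSqZeroExt.fst (h z hz)
    rw [hL] at this
    simp [two_mul, pow_two] at this
    linear_combination this
  have h2 : ∀ z, ‖z‖ < r → 2 * (z.fst * (F z).snd + z.snd * (F z).fst) = z.fst ^ 2 * (L 1).snd
      + 2 * z.fst * z.snd * (L nS).snd - 2 * z.fst ^ 2 * D.snd - 4 * z.fst * z.snd * D.fst := by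
    intro z hz
    have := congrArg TrivSqZeroExt.snd (h z hz)
    rw [hL] at this
    simp [two_mul, pow_two] at this
    linear_combination this
  have hpath : ∀ z : Sc, ‖z‖ < r → ContinuousAt (fun ε : ℂ => F (z + ε • 1)) 0 := by
    intro z hz
    refine ContinuousAt.comp (g := F) ?_ (by fun_prop)
    simpa using hF z hz
  have hsmall : ∀ z : Sc, ‖z‖ < r → ∀ᶠ ε in 𝓝 (0 : ℂ), ‖z + ε • (1 : Sc)‖ < r := by
    intro z hz
    have : Continuous fun ε : ℂ => ‖z + ε • (1 : Sc)‖ := by fun_prop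
    exact (this.tendsto' 0 ‖z‖ (by simp)).eventually_lt_const hz
  have hne : ∀ z : Sc, ∀ᶠ ε in 𝓝[≠] (0 : ℂ), (z + ε • (1 : Sc)).fst ≠ 0 := by
    intro z
    by_cases hz : z.fst = 0
    · filter_upwards [self_mem_nhdsWithin] with ε hε
      simpa [hz] using hε
    · refine nhdsWithin_le_nhds ?_
      have : Continuous fun ε : ℂ => z.fst + ε := by fun_prop
      have := (this.tendsto' 0 z.fst (by simp)).eventually_ne hz
      filter_upwards [this] with ε hε
      simpa using hε
  -- At `z.fst = 0` and `z.snd ≠ 0` the second component gives `(F z).fst = 0`, while the first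
  -- component, divided by `z.fst` and passed to the limit, gives `z.snd * (L nS).fst`.
  have hl : (L nS).fst = 0 := by
    set z : Sc := mkSc 0 ((r / 2 : ℝ) : ℂ) with hz
    have hz2 : z.snd ≠ 0 := by simp [hz, hr.ne']
    have hzn : ‖z‖ < r := by
      rw [norm_Sc, hz]
      simp [abs_of_pos hr, hr]
    have hF0 : (F z).fst = 0 := by
      have := h2 z hzn
      have hz1 : z.fst = 0 := by simp [hz]
      rw [hz1] at this
      have h3 : z.snd * (F z).fst = 0 := by linear_combination this / 2
      exact (mul_eq_zero.1 h3).resolve_left hz2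
    have key := eq_zero_of_smul_eq_zero_near (ψ := fun ε : ℂ =>
      2 * (F (z + ε • 1)).fst - (ε * (L 1).fst + 2 * z.snd * (L nS).fst - 2 * ε * D.fst))
      (by
        have := (TrivSqZeroExt.continuous_fst (R := ℂ) (M := ℂ)).continuousAt.comp (hpath z hzn)
        exact (continuousAt_const.mul this).sub (by fun_prop)) (by
      filter_upwards [nhdsWithin_le_nhds (hsmall z hzn), self_mem_nhdsWithin] with ε e1 e2
      have e3 := h1 _ e1
      have e4 : (z + ε • (1 : Sc)).fst = ε := by simp [hz]
      have e5 : (z + ε • (1 : Sc)).snd = z.snd := by simp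
      rw [e4, e5] at e3
      refine (mul_eq_zero.1 (?_ : ε * _ = 0)).resolve_left e2
      linear_combination e3)
    simp only [zero_smul, add_zero, hF0] at key
    have h3 : z.snd * (L nS).fst = 0 := by linear_combination -key / 2
    exact (mul_eq_zero.1 h3).resolve_left hz2
  refine ⟨(1 / 2 : ℂ) • L 1 - D, (L nS).snd - (L 1).fst, fun z hz => ?_⟩
  have key := eq_zero_of_smul_eq_zero_near (ψ := fun ε : ℂ => F (z + ε • 1) -
      ((z + ε • 1) * ((1 / 2 : ℂ) • L 1 - D) + mkSc 0 (z.snd * ((L nS).snd - (L 1).fst))))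
    ((hpath z hz).sub (by fun_prop)) (by
      filter_upwards [nhdsWithin_le_nhds (hsmall z hz), hne z] with ε e1 e2
      have e3 := h1 _ e1
      have e4 := h2 _ e1
      have e5 : (z + ε • (1 : Sc)).snd = z.snd := by simp
      rw [hl] at e3
      rw [e5] at e3 e4
      set x := (z + ε • (1 : Sc)) with hx
      have e6 : (F x).fst = x.fst * ((1 / 2) * (L 1).fst - D.fst) :=
        mul_left_cancel₀ e2 (by linear_combination e3 / 2)
      have e7 : (F x).snd = x.fst * ((1 / 2) * (L 1).snd - D.snd) +
          z.snd * ((1 / 2) * (L 1).fst - D.fst) + z.snd * ((L nS).snd - (L 1).fst) :=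
        mul_left_cancel₀ e2 (by linear_combination e4 / 2 - z.snd * e6)
      rw [sub_eq_zero]
      apply Sc.ext
      · rw [e6]; simp
      · rw [e7]; simp [e5])
  simp only [zero_smul, add_zero] at key
  exact sub_eq_zero.1 key

/-- A complex fourth root of the first component is lifted by one Newton step, which is exact
because `n² = 0`. The shift by `c ≠ 0` keeps the root invertible. -/
lemma exists_fourth_root {r : ℝ} (hr : 0 < r) (hr1 : r ≤ 1) {c : ℂ} (hc : c ≠ 0)
    (hcr : ‖c‖ < 2 * (r / 2) ^ 4) :
    ∀ᶠ W in 𝓝 (0 : Sc), ∃ v : Sc, ‖v‖ < r ∧ v.fst ≠ 0 ∧ W + mkSc c 0 = 2 * iS * v ^ 4 := by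
  have hcp : 0 < ‖c‖ := norm_pos_iff.2 hc
  have k1 : ∀ᶠ W in 𝓝 (0 : Sc), ‖W‖ < min (min (‖c‖ / 2) (r * ‖c‖)) (2 * (r / 2) ^ 4 - ‖c‖) := by
    refine (continuous_norm.tendsto' (0 : Sc) 0 (by simp)).eventually_lt_const ?_
    refine lt_min (lt_min ?_ ?_) ?_
    · positivity
    · positivity
    · linarith
  filter_upwards [k1] with W hW
  obtain ⟨hW1, hW3⟩ := lt_min_iff.1 hW
  obtain ⟨hW1, hW2⟩ := lt_min_iff.1 hW1
  obtain ⟨x, hx⟩ := IsAlgClosed.exists_pow_nat_eq ((W.fst + c) / (2 * Complex.I)) (n := 4) (by simp)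
  have hI : (2 * Complex.I) ≠ 0 := by simp
  have hxn : ‖x‖ ^ 4 = ‖W.fst + c‖ / 2 := by
    rw [← norm_pow, hx]; simp
  have l1 := norm_fst_le W
  have l2 := norm_snd_le W
  have l3 : ‖W.fst + c‖ < 2 * (r / 2) ^ 4 := by
    have := norm_add_le W.fst c; linarith
  have l4 : ‖c‖ / 2 < ‖W.fst + c‖ := by
    have := norm_sub_le (W.fst + c) W.fst
    rw [add_sub_cancel_left] at this
    linarith
  have hx1 : ‖x‖ < r / 2 := lt_of_pow_lt_pow_left₀ 4 (by positivity) (by linarith)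
  have hx0 : x ≠ 0 := by
    rintro rfl
    rw [norm_zero, zero_pow (by norm_num)] at hxn
    linarith
  have hx0' : 0 < ‖x‖ := norm_pos_iff.2 hx0
  have hx3 : ‖c‖ / 4 < ‖x‖ ^ 3 := by
    have : ‖x‖ ^ 4 ≤ ‖x‖ ^ 3 := pow_le_pow_of_le_one hx0'.le (by linarith) (by norm_num)
    linarith
  refine ⟨mkSc x (W.snd / (8 * Complex.I * x ^ 3)), ?_, by simpa using hx0, ?_⟩
  · rw [norm_Sc]
    simp only [fst_mkSc, snd_mkSc]
    have : ‖W.snd / (8 * Complex.I * x ^ 3)‖ < r / 2 := by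
      rw [norm_div]
      simp only [norm_mul, Complex.norm_I, norm_pow, mul_one, Complex.norm_ofNat]
      rw [div_lt_iff₀ (by positivity)]
      nlinarith
    linarith
  · apply Sc.ext
    · simp [two_mul, hx]
      field_simp
    · simp [two_mul, pow_succ]
      field_simp
      ring

/-! ### The model fields and the functional equation -/

/-- The `S`-holomorphic infinitesimal automorphisms
`Z (B + C W) ∂/∂Z + (A + 2 (B + B̄) W + 2 C W²) ∂/∂W`. -/
def sField : S × Sc × S →ₗ[ℝ] (Sc × Sc → Sc × Sc) where
  toFun c p := (p.1 * (c.2.1 + ofS c.2.2 * p.2),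
    ofS c.1 + 2 * (c.2.1 + star c.2.1) * p.2 + 2 * ofS c.2.2 * p.2 ^ 2)
  map_add' c d := by
    have h : ∀ X Y : S, ofS (X + Y) = ofS X + ofS Y := fun X Y => by apply Sc.ext <;> simp
    funext p
    simp only [Prod.fst_add, Prod.snd_add, h, star_add, Pi.add_apply, Prod.mk_add_mk,
      Prod.mk.injEq]
    constructor <;> ring
  map_smul' r c := by
    have h : ∀ X : S, ofS (r • X) = r • ofS X := fun X => by apply Sc.ext <;> simp
    funext p
    simp only [Prod.smul_fst, Prod.smul_snd, h, star_smul, star_trivial, RingHom.id_apply,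
      Pi.smul_apply, Prod.smul_mk, smul_add, smul_mul_assoc, mul_smul_comm,
      mul_add, add_mul]

/-- The identity governing tangent fields once they are known to be linear in `Z`. -/
lemma exists_functional {f : Sc × Sc → Sc × Sc} (hf : AnalyticAt ℂ f 0)
    (ht : ∀ᶠ p in 𝓝 (0 : Sc × Sc), rho p = 0 → fderiv ℝ rho p (f p) = 0) :
    ∃ r > 0, r ≤ 1 ∧ ∃ (g a : Sc → Sc) (q : Sc → ℂ),
      (∀ w, ‖w‖ < r → star (g (star w)) = g w) ∧
      (∀ z w, ‖z‖ < r → ‖w‖ < r → f (z, w) = (z * a w + mkSc 0 (z.snd * q w), g w)) ∧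
      ∀ z ζ w ω : Sc, ‖z‖ < r → ‖ζ‖ < r → ‖w‖ < r → ‖ω‖ < r →
        w - ω = 2 * iS * (z ^ 2 * ζ ^ 2) →
        g w - g ω = 4 * iS * (z ^ 2 * ζ ^ 2 * (a w + star (a (star ω))) +
          mkSc 0 (z.fst * ζ.fst * (ζ.fst * z.snd * q w + z.fst * ζ.snd * star (q (star ω))))) := by
  obtain ⟨r0, hr0, hd, heq⟩ := exists_polarized hf ht
  set r := min r0 1 with hrdef
  have hr : 0 < r := by positivity
  have hrr : ∀ x, x < r → x < r0 := fun x hx => hx.trans_le (min_le_left _ _)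
  have hn0 : ‖(0 : Sc)‖ < r0 := by simpa using hr0
  have hp : ∀ z w : Sc, ‖z‖ < r → ‖w‖ < r → ‖(z, w)‖ < r0 := by
    intro z w hz hw
    rw [Prod.norm_def]
    exact max_lt (hrr _ hz) (hrr _ hw)
  let g : Sc → Sc := fun w => (f (0, w)).2
  have hg1 : ∀ z w, ‖z‖ < r → ‖w‖ < r → (f (z, w)).2 = star (g (star w)) := by
    intro z w hz hw
    -- At `ζ = 0` the right side vanishes and the constraint reads `w = ω`.
    have := heq z 0 w w (hrr _ hz) hn0 (hrr _ hw) (hrr _ hw) (by simp)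
    rw [star_zero] at this
    rw [← sub_eq_zero, this]
    simp
  have hn0' : ‖(0 : Sc)‖ < r := by simpa using hr
  have hg2 : ∀ w, ‖w‖ < r → star (g (star w)) = g w := fun w hw => (hg1 0 w hn0' hw).symm
  have hg3 : ∀ z w, ‖z‖ < r → ‖w‖ < r → (f (z, w)).2 = g w := fun z w hz hw => by
    rw [hg1 z w hz hw, hg2 w hw]
  have heq' : ∀ z ζ w ω : Sc, ‖z‖ < r → ‖ζ‖ < r → ‖w‖ < r → ‖ω‖ < r →
        w - ω = 2 * iS * (z ^ 2 * ζ ^ 2) →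
        g w - g ω = 4 * iS * (z * ζ ^ 2 * (f (z, w)).1 +
          z ^ 2 * ζ * star (f (star ζ, star ω)).1) := by
    intro z ζ w ω hz hζ hw hω h
    rw [← heq z ζ w ω (hrr _ hz) (hrr _ hζ) (hrr _ hw) (hrr _ hω) h, hg3 z w hz hw,
      hg3 _ _ (by rwa [norm_star]) (by rwa [norm_star]), hg2 ω hω]
  have hlin : ∀ ω, ‖ω‖ < r → ∃ (a : Sc) (q : ℂ), ∀ z, ‖z‖ < r →
      (f (z, ω)).1 = z * a + mkSc 0 (z.snd * q) := by
    intro ω hω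
    have hFb : DifferentiableAt ℂ (fun ζ => star (f (star ζ, star ω)).1) 0 := by
      have h1 : DifferentiableAt ℂ (fun ζ => (f (ζ, star ω)).1) 0 := by
        refine DifferentiableAt.fst (DifferentiableAt.comp (g := f) 0 (hd _ ?_) (by fun_prop))
        exact hp _ _ hn0' (by rwa [norm_star])
      have := h1.star_star
      rwa [star_zero] at this
    have hgd : DifferentiableAt ℂ g ω :=
      DifferentiableAt.snd (DifferentiableAt.comp (g := f) ω (hd _ (hp _ _ hn0' hω))
        (by fun_prop))
    obtain ⟨L, D, hLD⟩ := first_order (F := fun z w => (f (z, w)).1) hr hω (fun z hz => by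
        refine ContinuousAt.fst (ContinuousAt.comp (g := f) (hd _ (hp _ _ hz hω)).continuousAt ?_)
        fun_prop) hFb hgd
      (fun z ζ w hz hζ hw h => heq' z ζ w ω hz hζ hw hω h)
    exact linear_of_mul_self (F := fun z => (f (z, ω)).1) hr (fun z hz => by
        refine ContinuousAt.fst (ContinuousAt.comp (g := f) (hd _ (hp _ _ hz hω)).continuousAt ?_)
        fun_prop) hLD
  choose! a q haq using hlin
  refine ⟨r, hr, min_le_right _ _, g, a, q, hg2, fun z w hz hw => ?_, ?_⟩
  · exact Prod.ext (haq w hw z hz) (hg3 z w hz hw)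
  · intro z ζ w ω hz hζ hw hω h
    rw [heq' z ζ w ω hz hζ hw hω h, haq w hw z hz,
      haq (star ω) (by rwa [norm_star]) (star ζ) (by rwa [norm_star])]
    congr 1
    apply Sc.ext
    · simp [pow_two]; ring
    · simp [pow_two]; ring

/-! ### Solution of the functional equation -/

lemma fst_two : (2 : Sc).fst = 2 := by
  rw [← one_add_one_eq_two, TrivSqZeroExt.fst_add, TrivSqZeroExt.fst_one]; norm_num

lemma four_mul_iS : 4 * iS = mkSc (4 * Complex.I) 0 := by
  have : (4 : Sc) = 2 * 2 := by norm_num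
  rw [this]
  apply Sc.ext
  · simp [two_mul, add_mul]; ring
  · simp [two_mul, add_mul]

lemma X0_eq (p : Sc × Sc) : X0 p = (nS * mkSc p.1.snd 0, nS * mkSc p.2.snd 0) := by
  apply Prod.ext <;> apply Sc.ext <;> simp [X0]

theorem exists_parameters {f : Sc × Sc → Sc × Sc} (hf : AnalyticAt ℂ f 0)
    (ht : ∀ᶠ p in 𝓝 (0 : Sc × Sc), rho p = 0 → fderiv ℝ rho p (f p) = 0) :
    ∃ (c : S × Sc × S) (κ : ℝ), ∀ᶠ p in 𝓝 (0 : Sc × Sc), f p = sField c p + κ • X0 p := by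
  obtain ⟨r, hr, hr1, g, a, q, hg, hfe, H⟩ := exists_functional hf ht
  -- The pairs `(v, v)` and `(v(1 + τn), v(1 - τn))` have the same `z²ζ²`; subtracting their
  -- equations leaves `τ v₁⁴ (q w - star (q (star ω)))`.
  have hq : ∀ v w ω : Sc, ‖v‖ < r → v.fst ≠ 0 → ‖w‖ < r → ‖ω‖ < r → w - ω = 2 * iS * v ^ 4 →
      q w = star (q (star ω)) := by
    intro v w ω hv hv0 hw hω h
    have c1 : ∀ s : ℂ, ∀ᶠ τ in 𝓝[≠] (0 : ℂ), ‖v * (1 + (s * τ) • nS)‖ < r := by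
      intro s
      refine nhdsWithin_le_nhds ?_
      have : Continuous fun τ : ℂ => ‖v * (1 + (s * τ) • nS)‖ := by fun_prop
      exact (this.tendsto' 0 ‖v‖ (by simp)).eventually_lt_const hv
    obtain ⟨τ, ⟨h1, h2⟩, h3⟩ := (((c1 1).and (c1 (-1))).and self_mem_nhdsWithin).exists
    have e1 := H v v w ω hv hv hw hω (by rw [h]; ring)
    have hN : (τ • nS) ^ 2 = 0 := by rw [smul_pow, nS_sq, smul_zero]
    simp only [one_mul, neg_one_mul, neg_smul] at h1 h2
    have h4 : (v * (1 + τ • nS)) ^ 2 * (v * (1 + -(τ • nS))) ^ 2 = v ^ 2 * v ^ 2 := by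
      linear_combination (v ^ 4 * ((τ • nS) ^ 2 - 2)) * hN
    have e2 := H _ _ w ω h1 h2 hw hω (by rw [h, h4]; ring)
    rw [e1, h4] at e2
    have e3 := congrArg TrivSqZeroExt.snd e2
    rw [four_mul_iS, mul_add, mul_add] at e3
    simp at e3
    have e4 : (τ * v.fst ^ 4) * (q w - star (q (star ω))) = 0 := by
      simp only [Complex.star_def]
      linear_combination (Complex.I / 4) * e3 + (τ * v.fst ^ 4) *
        (q w - (starRingEnd ℂ) (q (star ω))) * Complex.I_sq
    exact sub_eq_zero.1 ((mul_eq_zero.1 e4).resolve_left (mul_ne_zero h3 (pow_ne_zero 4 hv0)))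
  -- This choice makes `2t = (r/2)⁴`, within the bound of `exists_fourth_root`, and keeps `T 1` and
  -- `T 2` in the ball of radius `r`.
  set t : ℝ := (r / 2) ^ 4 / 2 with ht0
  have htp : 0 < t := by positivity
  set T : ℕ → Sc := fun k => mkSc ((k * t : ℝ) : ℂ) 0 with hT
  have hTs : ∀ k, star (T k) = T k := fun k => by apply Sc.ext <;> simp [hT]
  have hr4 : (r / 2) ^ 4 ≤ r / 2 := pow_le_of_le_one (by positivity) (by linarith) (by norm_num)
  have hTn : ∀ k, k ≤ 2 → ‖T k‖ < r := by
    intro k hk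
    have hk' : (k : ℝ) ≤ 2 := by exact_mod_cast hk
    have : ‖T k‖ = k * t := by
      rw [norm_Sc]
      simp [hT, abs_of_pos htp]
    rw [this]
    nlinarith
  -- Since `v.fst ≠ 0`, related points differ by an invertible element. Points near `0` are
  -- therefore compared with `T 1` and `T 2` rather than with `0`.
  let Rel : Sc → Sc → Prop := fun w ω => ‖w‖ < r ∧ ‖ω‖ < r ∧
    ∃ v : Sc, ‖v‖ < r ∧ v.fst ≠ 0 ∧ w - ω = 2 * iS * v ^ 4
  have hroot : ∀ x : ℝ, x ≠ 0 → |x| ≤ 2 * t → ∀ᶠ W in 𝓝 (0 : Sc), ∃ v : Sc, ‖v‖ < r ∧ v.fst ≠ 0 ∧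
      W + mkSc x 0 = 2 * iS * v ^ 4 := by
    intro x hx hxt
    refine exists_fourth_root hr hr1 (by exact_mod_cast hx) ?_
    rw [Complex.norm_real, Real.norm_eq_abs, ht0] at *
    have : 0 < (r / 2) ^ 4 := by positivity
    linarith
  have hrel : ∀ k, 1 ≤ k → k ≤ 2 → ∀ᶠ W in 𝓝 (0 : Sc), Rel W (T k) ∧ Rel (T k) W := by
    intro k h1 h2
    have hk1 : (1 : ℝ) ≤ k := by exact_mod_cast h1
    have hk2 : (k : ℝ) ≤ 2 := by exact_mod_cast h2
    have hkt : 0 < k * t := by positivity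
    have e1 := hroot (-(k * t)) (by linarith) (by rw [abs_neg, abs_of_pos hkt]; nlinarith)
    have e2 := hroot (k * t) (by linarith) (by rw [abs_of_pos hkt]; nlinarith)
    have e3 : Tendsto (fun W : Sc => -W) (𝓝 0) (𝓝 0) := continuous_neg.tendsto' 0 0 (by simp)
    have e4 := (continuous_norm.tendsto' (0 : Sc) 0 (by simp)).eventually_lt_const hr
    filter_upwards [e1, e3.eventually e2, e4] with W hW1 hW2 hW
    refine ⟨⟨hW, hTn k h2, ?_⟩, ⟨hTn k h2, hW, ?_⟩⟩
    · convert hW1 using 5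
      rw [sub_eq_add_neg]
      congr 1
      apply Sc.ext <;> simp [hT]
    · convert hW2 using 5
      rw [sub_eq_add_neg, add_comm]
  have hrel12 : Rel (T 1) (T 2) ∧ Rel (T 2) (T 1) := by
    have e1 := (hroot (-t) (by linarith) (by rw [abs_neg, abs_of_pos htp]; linarith)).self_of_nhds
    have e2 := (hroot t (by linarith) (by rw [abs_of_pos htp]; linarith)).self_of_nhds
    refine ⟨⟨hTn 1 (by norm_num), hTn 2 le_rfl, ?_⟩, ⟨hTn 2 le_rfl, hTn 1 (by norm_num), ?_⟩⟩
    · convert e1 using 5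
      apply Sc.ext
      · simp [hT]; ring
      · simp [hT]
    · convert e2 using 5
      apply Sc.ext
      · simp [hT]; ring
      · simp [hT]
  have hqR : ∀ w ω, Rel w ω → q w = star (q (star ω)) := by
    rintro w ω ⟨hw, hω, v, hv, hv0, h⟩
    exact hq v w ω hv hv0 hw hω h
  have hrel1 := hrel 1 le_rfl (by norm_num)
  have hrel2 := hrel 2 (by norm_num) le_rfl
  have hR01 := hrel1.self_of_nhds
  have hR02 := hrel2.self_of_nhds
  -- the coefficient of `X0`
  obtain ⟨κ, hκ⟩ : ∃ κ : ℝ, (κ : ℂ) = q 0 := by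
    refine ⟨(q 0).re, Complex.conj_eq_iff_re.1 ?_⟩
    -- Around the odd cycle `0, T 1, T 2, 0` the value `q 0` is conjugated three times, hence it is
    -- real.
    have e1 := hqR _ _ hR01.1
    have e2 := hqR _ _ hrel12.1
    have e3 := hqR _ _ hR02.2
    rw [hTs] at e1 e2
    rw [star_zero] at e3
    rw [e2, e3] at e1
    simpa using e1.symm
  have hq1 : ∀ W, Rel W (T 1) → q W = κ := by
    intro W hW
    rw [hκ, hqR _ _ hW, hqR _ _ hR01.1]
  have hκs : star (κ : ℂ) = κ := Complex.conj_ofReal κ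
  have hqc : ∀ W, Rel W (T 1) → Rel (T 1) W → star (q (star W)) = κ := by
    intro W _ hW
    rw [← hqR _ _ hW, ← hκs, hκ, hqR _ _ hR01.2, star_zero]
  have hqT1 : q (T 1) = κ := by
    rw [hqR _ _ hR01.2, star_zero, ← hκ, hκs]
  have hqT2 : q (T 2) = κ := hq1 _ hrel12.2
  -- Second component of the field after subtraction of `κ X0`.
  let G : Sc → Sc := fun w => g w - mkSc 0 (κ * w.snd)
  have hfun : ∀ w ω, Rel w ω → q w = κ → star (q (star ω)) = κ →
      G w - G ω = 2 * (w - ω) * (a w + star (a (star ω))) := by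
    rintro w ω ⟨hw, hω, v, hv, hv0, h⟩ h1 h2
    have h3 := H v v w ω hv hv hw hω (by rw [h]; ring)
    have h4 : mkSc 0 (κ * w.snd) - mkSc 0 (κ * ω.snd) = 4 * iS * mkSc 0 (v.fst * v.fst *
        (v.fst * v.snd * q w + v.fst * v.snd * star (q (star ω)))) := by
      have h5 := congrArg TrivSqZeroExt.snd h
      simp [two_mul, pow_succ] at h5
      rw [h1, h2, four_mul_iS]
      apply Sc.ext
      · simp
      · simp
        linear_combination κ * h5
    simp only [G]
    linear_combination h3 - h4 - 2 * (a w + star (a (star ω))) * h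
  have hGs : ∀ w, ‖w‖ < r → star (G (star w)) = G w := by
    intro w hw
    simp only [G, star_sub, hg w hw]
    congr 1
    apply Sc.ext <;> simp
  have hcancel : ∀ w ω Z : Sc, Rel w ω → (w - ω) * Z = 0 → Z = 0 := by
    rintro w ω Z ⟨-, -, v, -, hv0, h⟩ hZ
    refine eq_zero_of_mul_eq_zero ?_ hZ
    rw [h]
    simp [pow_succ, hv0, fst_two]
  -- Adding `hfun` for `(w, ω)` and for `(ω, w)` cancels `G`, and `w - ω` can be divided out.
  have hθ : ∀ w ω, Rel w ω → Rel ω w → q w = κ → q ω = κ → star (q (star ω)) = κ →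
      star (q (star w)) = κ → a w - star (a (star w)) = a ω - star (a (star ω)) := by
    intro w ω h1 h2 k1 k2 k3 k4
    have e1 := hfun w ω h1 k1 k3
    have e2 := hfun ω w h2 k2 k4
    rw [← sub_eq_zero]
    refine eq_zero_of_two_mul (hcancel w ω _ h1 ?_)
    linear_combination -e1 - e2
  have hqT1' : star (q (star (T 1))) = κ := by rw [hTs, hqT1, hκs]
  have hqT2' : star (q (star (T 2))) = κ := by rw [hTs, hqT2, hκs]
  have hθ12 := hθ _ _ hrel12.1 hrel12.2 hqT1 hqT2 hqT2' hqT1'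
  rw [hTs, hTs] at hθ12
  set θ : Sc := (1 / 2 : ℂ) • (a (T 1) - star (a (T 1))) with hθdef
  have h2θ : a (T 1) - star (a (T 1)) = 2 * θ := by
    rw [hθdef, mul_smul_comm, two_mul, ← two_smul ℂ, smul_smul]; norm_num
  have hθs : star θ = -θ := by
    rw [hθdef, star_smul, star_sub, star_star, ← smul_neg, neg_sub]
    simp
  rw [h2θ] at hθ12
  set s1 := a (T 1) - θ with hs1
  set s2 := a (T 2) - θ with hs2
  have hs1s : star s1 = s1 := by
    rw [hs1, star_sub, hθs]; linear_combination -h2θ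
  have hs2s : star s2 = s2 := by
    rw [hs2, star_sub, hθs]; linear_combination hθ12
  set u : Sc := mkSc ((t⁻¹ : ℝ) : ℂ) 0 with hu
  have hus : star u = u := by apply Sc.ext <;> simp [hu]
  have hut : u * T 1 = 1 := by
    apply Sc.ext
    · simp only [hu, hT, fst_mulSc, fst_mkSc]
      rw [← Complex.ofReal_mul]
      simp [htp.ne']
    · simp [hu, hT]
  have hT2 : T 2 = 2 * T 1 := by
    apply Sc.ext
    · simp [hT, two_mul]
    · simp [hT, two_mul]
  -- Here `u` is the inverse of `T 1 = T 2 - T 1`, so `C` is the slope of the real part of `a`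
  -- between the two reference points.
  obtain ⟨C, hC⟩ := exists_ofS (Z := u * (s2 - s1)) (by
    rw [star_mul, star_sub, hs1s, hs2s, hus, mul_comm])
  have e12 := hfun _ _ hrel12.1 hqT1 hqT2'
  obtain ⟨A, hA⟩ := exists_ofS
    (Z := G (T 1) - 4 * (2 * s1 - s2) * T 1 - 2 * ofS C * T 1 ^ 2) (by
    have h4 : star (4 : Sc) = 4 := star_ofNat 4
    have h2 : star (2 : Sc) = 2 := star_ofNat 2
    have hG1 : star (G (T 1)) = G (T 1) := by
      conv_rhs => rw [← hGs _ (hTn 1 (by norm_num)), hTs]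
    simp only [star_sub, star_mul, star_pow, hs1s, hs2s, hTs, star_ofS, hG1, h4, h2]
    ring)
  refine ⟨(A, (2 * s1 - s2) + θ, C), κ, ?_⟩
  have n1 : ∀ᶠ p in 𝓝 (0 : Sc × Sc), Rel p.2 (T 1) ∧ Rel (T 1) p.2 :=
    (continuous_snd.tendsto' (0 : Sc × Sc) 0 rfl).eventually hrel1
  have n2 : ∀ᶠ p in 𝓝 (0 : Sc × Sc), Rel p.2 (T 2) ∧ Rel (T 2) p.2 :=
    (continuous_snd.tendsto' (0 : Sc × Sc) 0 rfl).eventually hrel2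
  have n3 : ∀ᶠ p in 𝓝 (0 : Sc × Sc), ‖p.1‖ < r :=
    ((continuous_fst.norm).tendsto' (0 : Sc × Sc) 0 (by simp)).eventually_lt_const hr
  filter_upwards [n1, n2, n3] with p h1 h2 h3
  obtain ⟨z, w⟩ := p
  simp only at h1 h2 h3
  have qw := hq1 _ h1.1
  have qw' := hqc _ h1.1 h1.2
  have d1 := hθ _ _ h1.1 h1.2 qw hqT1 hqT1' qw'
  rw [hTs, h2θ] at d1
  have g1 := hfun _ _ h1.1 qw hqT1'
  have g2 := hfun _ _ h2.2 hqT2 qw'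
  rw [hTs] at g1 e12
  have a1 : a (T 1) = s1 + θ := by rw [hs1]; ring
  have a2 : a (T 2) = s2 + θ := by rw [hs2]; ring
  have b1 : star (a (T 1)) = s1 - θ := by rw [hs1]; linear_combination -h2θ
  have b2 : star (a (T 2)) = s2 - θ := by rw [hs2]; linear_combination hθ12
  have bw : star (a (star w)) = a w - 2 * θ := by linear_combination -d1
  rw [b1] at g1
  rw [a2, bw] at g2
  rw [a1, b2] at e12
  -- Summing `hfun` around the triangle `w`, `T 1`, `T 2` eliminates `G` and leaves a linear
  -- equation for `a w`.
  have key : a w = (2 * s1 - s2) + θ + ofS C * w := by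
    have h4 : 2 * (T 1 * (a w - θ - (2 * s1 - s2)) - w * (s2 - s1)) = 0 := by
      linear_combination -(g1 + g2 + e12) - 2 * (a w - θ - s1) * hT2
    have h5 := eq_zero_of_two_mul h4
    rw [hC]
    linear_combination u * h5 - (a w - θ - (2 * s1 - s2)) * hut
  have hCT : ofS C * T 1 = s2 - s1 := by rw [hC]; linear_combination (s2 - s1) * hut
  have hGw : G w = ofS A + 4 * (2 * s1 - s2) * w + 2 * ofS C * w ^ 2 := by
    rw [hA]
    linear_combination g1 + 2 * (w - T 1) * key - 2 * (w - T 1) * hCT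
  have hgw : g w = G w + mkSc 0 (κ * w.snd) := by simp [G]
  rw [hfe z w h3 h1.1.1, qw, hgw, hGw, key, X0_eq]
  have hsn : star ((2 * s1 - s2) + θ) = (2 * s1 - s2) - θ := by
    have h2 : star (2 : Sc) = 2 := star_ofNat 2
    rw [star_add, star_sub, star_mul, hs1s, hs2s, hθs, h2]; ring
  apply Prod.ext
  · simp only [sField, LinearMap.coe_mk, AddHom.coe_mk, Prod.fst_add, Prod.smul_fst]
    congr 1
    apply Sc.ext
    · simp
    · simp [mul_comm]
  · simp only [sField, LinearMap.coe_mk, AddHom.coe_mk, Prod.snd_add, Prod.smul_snd, hsn]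
    congr 1
    · ring
    · apply Sc.ext <;> simp

/-! ### Tangency of the fields and the structure of `aut Q` -/

lemma analyticOnNhd_sField (c : S × Sc × S) : AnalyticOnNhd ℂ (sField c) Set.univ := by
  intro p _
  have h1 : AnalyticAt ℂ (fun p : Sc × Sc => p.1) p := analyticAt_fst
  have h2 : AnalyticAt ℂ (fun p : Sc × Sc => p.2) p := analyticAt_snd
  exact (h1.mul (analyticAt_const.add (analyticAt_const.mul h2))).prod
    ((analyticAt_const.add (analyticAt_const.mul h2)).add (analyticAt_const.mul (h2.pow 2)))

/-- The additional field as a continuous linear map. -/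
def X0L : Sc × Sc →L[ℂ] Sc × Sc :=
  ContinuousLinearMap.prodMap
    ((TrivSqZeroExt.inrCLM ℂ ℂ).comp (TrivSqZeroExt.sndCLM ℂ ℂ))
    ((TrivSqZeroExt.inrCLM ℂ ℂ).comp (TrivSqZeroExt.sndCLM ℂ ℂ))

lemma X0L_apply (p : Sc × Sc) : X0L p = X0 p := by
  apply Prod.ext <;> apply Sc.ext <;> simp [X0L, X0]

lemma analyticOnNhd_X0 : AnalyticOnNhd ℂ X0 Set.univ := by
  rw [← funext X0L_apply]
  exact X0L.analyticOnNhd _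

lemma real_smul_eq (κ : ℝ) (p : Sc × Sc) : κ • p = (κ : ℂ) • p := (Complex.coe_smul κ p).symm

lemma analyticOnNhd_field (c : S × Sc × S) (κ : ℝ) :
    AnalyticOnNhd ℂ (fun p => sField c p + κ • X0 p) Set.univ := by
  intro p hp
  simp only [real_smul_eq]
  exact (analyticOnNhd_sField c p hp).add ((analyticOnNhd_X0 p hp).const_smul (c := (κ : ℂ)))

lemma snd_two : (2 : Sc).snd = 0 := by
  rw [← one_add_one_eq_two, TrivSqZeroExt.snd_add, TrivSqZeroExt.snd_one]; norm_num

lemma sField_tangent (c : S × Sc × S) {p : Sc × Sc} (hp : rho p = 0) :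
    fderiv ℝ rho p (sField c p) = 0 := by
  rw [rho_eq_zero_iff] at hp
  rw [fderiv_rho_eq_zero_iff]
  have h2 : star (2 : Sc) = 2 := star_ofNat 2
  simp only [sField, LinearMap.coe_mk, AddHom.coe_mk, star_add, star_mul, star_pow, star_star,
    star_ofS, h2]
  linear_combination (2 * (c.2.1 + star c.2.1) + 2 * ofS c.2.2 * (p.2 + star p.2)) * hp

lemma X0_tangent {p : Sc × Sc} (hp : rho p = 0) : fderiv ℝ rho p (X0 p) = 0 := by
  rw [rho_eq_zero_iff] at hp
  rw [fderiv_rho_eq_zero_iff, four_mul_iS]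
  have h := congrArg TrivSqZeroExt.snd hp
  simp [fst_two, snd_two, pow_two] at h
  apply Sc.ext
  · simp [X0, pow_two]
  · simp [X0, pow_two]
    linear_combination h

lemma sField_mem_aut (c : S × Sc × S) : germ (sField c) ∈ aut rho :=
  ⟨sField c, rfl, analyticOnNhd_sField c 0 trivial,
    Eventually.of_forall fun _ hp => sField_tangent c hp⟩

lemma X0_mem_aut : germ X0 ∈ aut rho :=
  ⟨X0, rfl, analyticOnNhd_X0 0 trivial, Eventually.of_forall fun _ hp => X0_tangent hp⟩

lemma SHolFun.congr {u v : Sc × Sc → Sc} (hu : SHolFun u) (h : u =ᶠ[𝓝 0] v) : SHolFun v := by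
  obtain ⟨c, hc⟩ := hu
  refine ⟨c, ?_⟩
  filter_upwards [hc, h] with p h1 h2
  rwa [← h2]

lemma sHolFun_monomial (a : Sc) (j k : ℕ) : SHolFun fun p => a * p.1 ^ j * p.2 ^ k := by
  refine ⟨Pi.single (j, k) a, Eventually.of_forall fun p => ?_⟩
  convert hasSum_single (j, k) ?_ using 1
  · simp
  · intro b hb
    simp [Pi.single_eq_of_ne hb]

lemma sHol_germ_iff (h : Sc × Sc → Sc × Sc) :
    SHol (germ h) ↔ SHolFun (fun p => (h p).1) ∧ SHolFun (fun p => (h p).2) := by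
  constructor
  · rintro ⟨f, hf, h1, h2⟩
    have hf' : h =ᶠ[𝓝 0] f := Germ.coe_eq.1 hf
    exact ⟨h1.congr (hf'.mono fun p hp => congrArg Prod.fst hp.symm),
      h2.congr (hf'.mono fun p hp => congrArg Prod.snd hp.symm)⟩
  · rintro ⟨h1, h2⟩
    exact ⟨h, rfl, h1, h2⟩

lemma sField_sHol (c : S × Sc × S) : SHol (germ (sField c)) := by
  rw [sHol_germ_iff]
  constructor
  · refine ((sHolFun_monomial c.2.1 1 0).add (sHolFun_monomial (ofS c.2.2) 1 1)).congr
      (Eventually.of_forall fun p => ?_)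
    simp only [sField, LinearMap.coe_mk, AddHom.coe_mk]
    ring
  · refine (((sHolFun_monomial (ofS c.1) 0 0).add
      (sHolFun_monomial (2 * (c.2.1 + star c.2.1)) 0 1)).add
      (sHolFun_monomial (2 * ofS c.2.2) 0 2)).congr (Eventually.of_forall fun p => ?_)
    simp only [sField, LinearMap.coe_mk, AddHom.coe_mk]
    ring

lemma sField_mem_autS (c : S × Sc × S) : germ (sField c) ∈ autS :=
  ⟨sField_mem_aut c, sField_sHol c⟩

/-- An `S`-holomorphic function has the same derivative along `1` and along `n`. -/
lemma SHolFun.exists_deriv {u : Sc × Sc → Sc} (hu : SHolFun u) : ∃ c₀ c₁ : Sc,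
    HasDerivAt (fun ε : ℂ => u (ε • 1, 0)) c₁ 0 ∧
      ∀ᶠ ε : ℂ in 𝓝 0, u (ε • nS, 0) = c₀ + ε • (c₁ * nS) := by
  obtain ⟨c, hc⟩ := hu
  have hinj : Function.Injective fun k : ℕ => (k, 0) := fun a b h => (Prod.mk.inj h).1
  have hZ : ∀ Z : Sc, HasSum (fun j : ℕ × ℕ => c j * Z ^ j.1 * (0 : Sc) ^ j.2) (u (Z, 0)) →
      HasSum (fun k : ℕ => c (k, 0) * Z ^ k) (u (Z, 0)) := by
    intro Z h
    rw [← hinj.hasSum_iff] at h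
    · simpa [Function.comp_def] using h
    · rintro ⟨a, b⟩ hb
      have : b ≠ 0 := by
        rintro rfl
        exact hb ⟨a, rfl⟩
      simp [this]
  have ht : ∀ d : Sc, Tendsto (fun ε : ℂ => ((ε • d, 0) : Sc × Sc)) (𝓝 0) (𝓝 0) := by
    intro d
    have : Continuous fun ε : ℂ => ((ε • d, 0) : Sc × Sc) := by fun_prop
    exact this.tendsto' 0 0 (by simp)
  refine ⟨c (0, 0), c (1, 0), ?_, ?_⟩
  · let P : FormalMultilinearSeries ℂ ℂ Sc := fun k =>
      ContinuousMultilinearMap.mkPiRing ℂ (Fin k) (c (k, 0))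
    have hP : ∀ k, P.coeff k = c (k, 0) := by
      intro k
      simp [FormalMultilinearSeries.coeff, P]
    have h1 : HasFPowerSeriesAt (fun ε : ℂ => u (ε • 1, 0)) P 0 := by
      rw [hasFPowerSeriesAt_iff]
      filter_upwards [(ht 1).eventually hc] with ε hε
      rw [zero_add]
      refine (hZ _ hε).congr_fun ?_
      intro k
      rw [hP, smul_pow, one_pow, mul_smul_comm, mul_one]
    rw [← hP]
    exact h1.hasDerivAt
  · filter_upwards [(ht nS).eventually hc] with ε hε
    refine (hZ _ hε).unique ?_
    have : HasSum (fun k : ℕ => c (k, 0) * (ε • nS) ^ k)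
        (∑ k ∈ Finset.range 2, c (k, 0) * (ε • nS) ^ k) := by
      refine hasSum_sum_of_ne_finset_zero ?_
      intro k hk
      -- Since `n² = 0`, the series along `εn` stops after degree one, with the same coefficient `c
      -- (1, 0)` as the derivative along `1`.
      obtain ⟨m, rfl⟩ : ∃ m, k = m + 2 := ⟨k - 2, by simp at hk; omega⟩
      rw [smul_pow, pow_add nS, nS_sq]
      simp
    convert this using 1
    simp [Finset.sum_range_succ]

/-- The first component of `X0` vanishes along `1` but is `εn` along `εn`, which
`SHolFun.exists_deriv` forbids for a nonzero multiple. -/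
lemma autS_inf : autS ⊓ Submodule.span ℝ {germ X0} = ⊥ := by
  rw [eq_bot_iff]
  rintro X ⟨⟨-, f, hf, h1, -⟩, hX⟩
  obtain ⟨κ, rfl⟩ := Submodule.mem_span_singleton.1 hX
  have hf' : (κ • X0) =ᶠ[𝓝 0] f := Germ.coe_eq.1 hf
  obtain ⟨c₀, c₁, hd, hn⟩ := (h1.congr (v := fun p => κ • (X0 p).1)
    (hf'.symm.mono fun p hp => congrArg Prod.fst hp)).exists_deriv
  have hz : (fun ε : ℂ => κ • (X0 (ε • 1, 0)).1) = fun _ => 0 := by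
    funext ε
    apply Sc.ext <;> simp [X0]
  rw [hz] at hd
  have hc₁ : c₁ = 0 := hd.unique (hasDerivAt_const _ _)
  have hc₀ := hn.self_of_nhds
  obtain ⟨ε, hε, hε0⟩ := ((hn.filter_mono nhdsWithin_le_nhds).and
    (self_mem_nhdsWithin (a := (0 : ℂ)) (s := {0}ᶜ))).exists
  have hκ : κ = 0 := by
    rw [hc₁] at hε hc₀
    have e1 := congrArg TrivSqZeroExt.snd hε
    have e2 := congrArg TrivSqZeroExt.snd hc₀
    simp [X0] at e1 e2
    rw [← e2] at e1
    have : (κ : ℂ) * ε = 0 := by simpa using e1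
    simpa using (mul_eq_zero.1 this).resolve_right hε0
  simp [hκ]

lemma mem_aut_iff (X : Germ (𝓝 (0 : Sc × Sc)) (Sc × Sc)) :
    X ∈ aut rho ↔ ∃ (c : S × Sc × S) (κ : ℝ), X = germ (sField c) + κ • germ X0 := by
  constructor
  · rintro ⟨f, rfl, hf, ht⟩
    obtain ⟨c, κ, h⟩ := exists_parameters hf ht
    exact ⟨c, κ, Germ.coe_eq.2 h⟩
  · rintro ⟨c, κ, rfl⟩
    exact add_mem (sField_mem_aut c) ((aut rho).smul_mem κ X0_mem_aut)

lemma germ_X0_ne_zero : germ X0 ≠ 0 := by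
  intro h
  have h' : X0 =ᶠ[𝓝 0] 0 := Germ.coe_eq.1 h
  have ht : Tendsto (fun ε : ℂ => ((ε • nS, 0) : Sc × Sc)) (𝓝[≠] 0) (𝓝 0) := by
    have : Continuous fun ε : ℂ => ((ε • nS, 0) : Sc × Sc) := by fun_prop
    exact (this.tendsto' 0 0 (by simp)).mono_left nhdsWithin_le_nhds
  obtain ⟨ε, h1, h2⟩ := ((ht.eventually h').and self_mem_nhdsWithin).exists
  have := congrArg (fun p : Sc × Sc => p.1.snd) h1
  simp [X0] at this
  exact h2 this

lemma mem_autS_iff (X : Germ (𝓝 (0 : Sc × Sc)) (Sc × Sc)) :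
    X ∈ autS ↔ ∃ c : S × Sc × S, X = germ (sField c) := by
  constructor
  · intro hX
    obtain ⟨c, κ, rfl⟩ := (mem_aut_iff X).1 hX.1
    have h1 : κ • germ X0 ∈ autS := by
      simpa using autS.sub_mem hX (sField_mem_autS c)
    have h2 : κ • germ X0 ∈ autS ⊓ Submodule.span ℝ {germ X0} :=
      ⟨h1, Submodule.smul_mem _ _ (Submodule.mem_span_singleton_self _)⟩
    rw [autS_inf, Submodule.mem_bot] at h2
    exact ⟨c, by rw [h2, add_zero]⟩
  · rintro ⟨c, rfl⟩
    exact sField_mem_autS c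

/-- The parametrization of `aut_S Q`. -/
def sFieldGerm : S × Sc × S →ₗ[ℝ] Germ (𝓝 (0 : Sc × Sc)) (Sc × Sc) where
  toFun c := germ (sField c)
  map_add' c d := by rw [map_add]; rfl
  map_smul' r c := by rw [map_smul]; rfl

lemma autS_eq_range : autS = LinearMap.range sFieldGerm := by
  ext X
  rw [mem_autS_iff]
  exact exists_congr fun c => eq_comm

instance finiteDimensional_dualNumber {K : Type*} [AddCommGroup K] [Module ℝ K]
    [FiniteDimensional ℝ K] : FiniteDimensional ℝ (TrivSqZeroExt K K) :=
  inferInstanceAs (FiniteDimensional ℝ (K × K))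

instance : FiniteDimensional ℝ autS := by
  rw [autS_eq_range]
  infer_instance

lemma autS_sup : autS ⊔ Submodule.span ℝ {germ X0} = aut rho := by
  apply le_antisymm
  · refine sup_le (fun X hX => hX.1) ?_
    rw [Submodule.span_singleton_le_iff_mem]
    exact X0_mem_aut
  · intro X hX
    obtain ⟨c, κ, rfl⟩ := (mem_aut_iff X).1 hX
    exact Submodule.add_mem_sup (sField_mem_autS c)
      (Submodule.smul_mem _ _ (Submodule.mem_span_singleton_self _))

lemma finiteDimensional_aut : FiniteDimensional ℝ (aut rho) := by
  rw [← autS_sup]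
  infer_instance

lemma finrank_aut : Module.finrank ℝ (aut rho) = Module.finrank ℝ autS + 1 := by
  have h := Submodule.finrank_sup_add_finrank_inf_eq autS (Submodule.span ℝ {germ X0})
  rw [autS_sup, autS_inf, finrank_bot, add_zero, finrank_span_singleton germ_X0_ne_zero] at h
  exact h

/-! ### The inverse square root on dual numbers -/

/-- The binomial series `(1 + y)^(-1/2)` on `Sc`. -/
def invSqrt (y : Sc) : Sc := (binomialSeries Sc (-1 / 2 : ℂ)).sum y

lemma hasSum_cpow {x a : ℂ} (hx : ‖x‖ < 1) :
    HasSum (fun k : ℕ => Ring.choose a k * x ^ k) ((1 + x) ^ a) := by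
  have h := (Complex.one_add_cpow_hasFPowerSeriesOnBall_zero (a := a)).hasSum (y := x)
    (by simpa [Metric.mem_eball, edist_zero_right, enorm_eq_nnnorm, ← NNReal.coe_lt_coe] using hx)
  simpa only [binomialSeries_apply, List.ofFn_const, List.prod_replicate, smul_eq_mul, zero_add] using h

lemma hasSum_cpow_deriv {x a : ℂ} (hx : ‖x‖ < 1) :
    HasSum (fun k : ℕ => Ring.choose a k * (k * x ^ (k - 1))) (a * (1 + x) ^ (a - 1)) := by
  have h := (hasSum_cpow (a := a - 1) hx).mul_left a
  have h2 : HasSum (fun k : ℕ => Ring.choose a (k + 1) * (((k + 1 : ℕ) : ℂ) * x ^ (k + 1 - 1)))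
      (a * (1 + x) ^ (a - 1)) := by
    refine h.congr_fun fun k => ?_
    have := Ring.choose_smul_choose a (n := k + 1) (k := 1) (by omega)
    simp at this
    rw [Nat.add_sub_cancel]
    push_cast
    linear_combination x ^ k * this
  have h3 := (hasSum_nat_add_iff (f := fun k : ℕ => Ring.choose a k * (k * x ^ (k - 1))) 1).1 h2
  simpa using h3

/-- A power series at `x + yn` sums to its value at `x` plus `n y` times its derivative at `x`,
because `(x + yn)^k = x^k + k x^(k-1) y n`. -/
lemma hasSum_invSqrt_aux {y : Sc} (hy : ‖y‖ < 1) :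
    HasSum (fun k : ℕ => (Ring.choose (-1 / 2 : ℂ) k) • y ^ k)
      (mkSc ((1 + y.fst) ^ (-1 / 2 : ℂ)) (-1 / 2 * (1 + y.fst) ^ (-3 / 2 : ℂ) * y.snd)) := by
  have hx : ‖y.fst‖ < 1 := (norm_fst_le y).trans_lt hy
  have h1 := TrivSqZeroExt.hasSum_inl (M := ℂ) (hasSum_cpow (a := -1 / 2) hx)
  have h2 := TrivSqZeroExt.hasSum_inr (R := ℂ) ℂ ((hasSum_cpow_deriv (a := -1 / 2) hx).mul_right y.snd)
  have h3 := h1.add h2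
  have e : (-1 / 2 - 1 : ℂ) = -3 / 2 := by norm_num
  rw [e] at h3
  refine h3.congr_fun fun k => ?_
  apply Sc.ext
  · simp
  · simp
    ring

lemma invSqrt_eq {y : Sc} (hy : ‖y‖ < 1) : invSqrt y =
    mkSc ((1 + y.fst) ^ (-1 / 2 : ℂ)) (-1 / 2 * (1 + y.fst) ^ (-3 / 2 : ℂ) * y.snd) := by
  rw [← (hasSum_invSqrt_aux hy).tsum_eq, invSqrt, FormalMultilinearSeries.sum]
  simp [List.ofFn_const]

lemma hasSum_invSqrt {y : Sc} (hy : ‖y‖ < 1) :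
    HasSum (fun k : ℕ => (Ring.choose (-1 / 2 : ℂ) k) • y ^ k) (invSqrt y) := by
  rw [invSqrt_eq hy]
  exact hasSum_invSqrt_aux hy

lemma invSqrt_zero : invSqrt 0 = 1 := by
  rw [invSqrt_eq (by simp)]
  apply Sc.ext <;> simp

lemma one_add_mem_slitPlane {y : Sc} (hy : ‖y‖ < 1) : 1 + y.fst ∈ Complex.slitPlane :=
  Complex.mem_slitPlane_of_norm_lt_one ((norm_fst_le y).trans_lt hy)

lemma invSqrt_sq_mul {y : Sc} (hy : ‖y‖ < 1) : invSqrt y ^ 2 * (1 + y) = 1 := by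
  have hx : 1 + y.fst ≠ 0 := Complex.slitPlane_ne_zero (one_add_mem_slitPlane hy)
  set x := 1 + y.fst with hxd
  have h1 : (x ^ (-1 / 2 : ℂ)) ^ 2 * x = 1 := by
    rw [← Complex.cpow_nat_mul]
    norm_num
    rw [Complex.cpow_neg_one, inv_mul_cancel₀ hx]
  have h2 : x ^ (-3 / 2 : ℂ) * x = x ^ (-1 / 2 : ℂ) := by
    nth_rewrite 2 [← Complex.cpow_one x]
    rw [← Complex.cpow_add _ _ hx]
    norm_num
  rw [invSqrt_eq hy, ← hxd]
  apply Sc.ext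
  · simp [pow_two, ← hxd]
    linear_combination h1
  · simp [pow_two, ← hxd]
    linear_combination (-x ^ (-1 / 2 : ℂ) * y.snd) * h2

lemma one_add_inv {y : Sc} (hy : ‖y‖ < 1) : (1 + y)⁻¹ = invSqrt y ^ 2 := by
  have h1 := invSqrt_sq_mul hy
  have hx : (1 + y).fst ≠ 0 := by
    simpa using Complex.slitPlane_ne_zero (one_add_mem_slitPlane hy)
  have h2 := TrivSqZeroExt.inv_mul_cancel hx
  linear_combination invSqrt y ^ 2 * h2 - (1 + y)⁻¹ * h1

lemma differentiableAt_invSqrt {y : Sc} (hy : ‖y‖ < 1) : DifferentiableAt ℂ invSqrt y := by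
  have hev : invSqrt =ᶠ[𝓝 y] fun y => TrivSqZeroExt.inlCLM ℂ ℂ ((1 + y.fst) ^ (-1 / 2 : ℂ)) +
      TrivSqZeroExt.inrCLM ℂ ℂ (-1 / 2 * (1 + y.fst) ^ (-3 / 2 : ℂ) * y.snd) := by
    filter_upwards [continuous_norm.continuousAt.eventually_lt_const hy] with z hz
    rw [invSqrt_eq hz]
    rfl
  refine DifferentiableAt.congr_of_eventuallyEq ?_ hev
  have h1 : DifferentiableAt ℂ (fun y : Sc => y.fst) y :=
    (TrivSqZeroExt.fstCLM ℂ ℂ : Sc →L[ℂ] ℂ).differentiableAt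
  have h2 : DifferentiableAt ℂ (fun y : Sc => y.snd) y :=
    (TrivSqZeroExt.sndCLM ℂ ℂ : Sc →L[ℂ] ℂ).differentiableAt
  have h3 : ∀ a : ℂ, DifferentiableAt ℂ (fun y : Sc => (1 + y.fst) ^ a) y := fun a =>
    (h1.const_add 1).cpow_const (one_add_mem_slitPlane hy)
  exact ((TrivSqZeroExt.inlCLM ℂ ℂ).differentiableAt.comp y (h3 _)).add
    ((TrivSqZeroExt.inrCLM ℂ ℂ).differentiableAt.comp y (((h3 _).const_mul _).mul h2))

/-- Differentiate `φ² (1 + y) = 1` and multiply by `φ`. -/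
lemma hasFDerivAt_invSqrt {y : Sc} (hy : ‖y‖ < 1) : ∃ L : Sc →L[ℝ] Sc,
    HasFDerivAt invSqrt L y ∧ ∀ v, 2 * L v = -(invSqrt y ^ 3 * v) := by
  have h1 := ((differentiableAt_invSqrt hy).restrictScalars ℝ).hasFDerivAt
  refine ⟨_, h1, fun v => ?_⟩
  have h2 := (h1.mul h1).mul ((hasFDerivAt_id (𝕜 := ℝ) y).const_add 1)
  have h3 : (invSqrt * invSqrt * fun y : Sc => 1 + id y) =ᶠ[𝓝 y] fun _ => 1 := by
    filter_upwards [continuous_norm.continuousAt.eventually_lt_const hy] with z hz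
    simp only [Pi.mul_apply, id]
    linear_combination invSqrt_sq_mul hz
  have h4 := congrArg (fun L : Sc →L[ℝ] Sc => L v)
    ((h2.congr_of_eventuallyEq h3.symm).unique (hasFDerivAt_const 1 y))
  simp [smul_eq_mul] at h4
  have h5 := invSqrt_sq_mul hy
  set D := (fderiv ℝ invSqrt y) v
  linear_combination invSqrt y * h4 - 2 * D * h5

/-! ### `S`-holomorphy of the compositions -/

lemma sHolFun_of_hasSum (j m : ℕ) {d : ℕ → Sc} {v : Sc × Sc → Sc}
    (h : ∀ᶠ p in 𝓝 (0 : Sc × Sc), HasSum (fun k => d k * p.2 ^ k) (v p)) :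
    SHolFun fun p => p.1 ^ j * p.2 ^ m * v p := by
  have hinj : Function.Injective fun k : ℕ => (j, k + m) := fun a b h => by
    simpa using (Prod.mk.inj h).2
  refine ⟨fun i => if i.1 = j ∧ m ≤ i.2 then d (i.2 - m) else 0, ?_⟩
  filter_upwards [h] with p hp
  rw [← hinj.hasSum_iff]
  · refine (hp.mul_left (p.1 ^ j * p.2 ^ m)).congr_fun fun k => ?_
    simp [pow_add]
    ring
  · rintro ⟨a, b⟩ hab
    have : ¬(a = j ∧ m ≤ b) := by
      rintro ⟨rfl, hb⟩
      exact hab ⟨b - m, by simp [hb]⟩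
    simp [this]

lemma SHolFun.const_mul {u : Sc × Sc → Sc} (hu : SHolFun u) (a : Sc) :
    SHolFun fun p => a * u p := by
  obtain ⟨c, hc⟩ := hu
  refine ⟨fun j => a * c j, ?_⟩
  filter_upwards [hc] with p h1
  simpa [mul_assoc] using h1.mul_left a

lemma eventually_norm_mul_lt (C : Sc) : ∀ᶠ p in 𝓝 (0 : Sc × Sc), ‖-(C * p.2)‖ < 1 := by
  have : Continuous fun p : Sc × Sc => ‖-(C * p.2)‖ := by fun_prop
  exact (this.tendsto' 0 0 (by simp)).eventually_lt_const one_pos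

/-- Compositions of the three basic types of maps, near the origin. -/
lemma comp_apply {A C : S} {B : Sc} {p : Sc × Sc} (hp : ‖-(ofS C * p.2)‖ < 1) :
    (GNeg A ∘ GZero B ∘ GPos C) p = (B * (p.1 * invSqrt (-(ofS C * p.2))),
      B ^ 2 * star B ^ 2 * (p.2 * invSqrt (-(ofS C * p.2)) ^ 2) + ofS A) := by
  have h := one_add_inv hp
  rw [← sub_eq_add_neg] at h
  simp only [Function.comp_apply, GPos, GZero, GNeg, h]
  rfl

lemma sHol_comp (A C : S) (B : Sc) : SHol (germ (GNeg A ∘ GZero B ∘ GPos C)) := by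
  rw [sHol_germ_iff]
  constructor
  · have h1 : SHolFun fun p => B * (p.1 ^ 1 * p.2 ^ 0 * invSqrt (-(ofS C * p.2))) := by
      refine (sHolFun_of_hasSum 1 0 (d := fun k =>
        (Ring.choose (-1 / 2 : ℂ) k) • (-ofS C) ^ k) ?_).const_mul B
      filter_upwards [eventually_norm_mul_lt (ofS C)] with p hp
      refine (hasSum_invSqrt hp).congr_fun fun k => ?_
      rw [← neg_mul, mul_pow, smul_mul_assoc]
    refine h1.congr ?_
    filter_upwards [eventually_norm_mul_lt (ofS C)] with p hp
    rw [comp_apply hp]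
    ring
  · have h1 : SHolFun fun p => B ^ 2 * star B ^ 2 *
        (p.1 ^ 0 * p.2 ^ 1 * invSqrt (-(ofS C * p.2)) ^ 2) := by
      refine (sHolFun_of_hasSum 0 1 (d := fun k => ofS C ^ k) ?_).const_mul _
      filter_upwards [eventually_norm_mul_lt (ofS C)] with p hp
      rw [norm_neg] at hp
      have h2 := (summable_geometric_of_norm_lt_one hp).hasSum
      have h3 := mul_neg_geom_series _ hp
      have h4 := invSqrt_sq_mul (y := -(ofS C * p.2)) (by rwa [norm_neg])
      have h5 : ∑' i : ℕ, (ofS C * p.2) ^ i = invSqrt (-(ofS C * p.2)) ^ 2 := by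
        linear_combination invSqrt (-(ofS C * p.2)) ^ 2 * h3 - (∑' i : ℕ, (ofS C * p.2) ^ i) * h4
      rw [← h5]
      exact h2.congr_fun fun k => by rw [mul_pow]
    refine (h1.add (sHolFun_monomial (ofS A) 0 0)).congr ?_
    filter_upwards [eventually_norm_mul_lt (ofS C)] with p hp
    rw [comp_apply hp]
    ring

/-! ### Integral curves and time-one maps -/

/-- The union of the two traces is compact, so a locally Lipschitz field is Lipschitz on it and
Grönwall uniqueness applies on all of `[0, 1]`. -/
lemma integralCurve_unique {E : Type*} [NormedAddCommGroup E] [NormedSpace ℝ E] {P : E → E}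
    (hP : LocallyLipschitz P) {γ δ : ℝ → E}
    (hγ : ∀ t ∈ Set.Icc (0 : ℝ) 1, HasDerivWithinAt γ (P (γ t)) (Set.Icc (0 : ℝ) 1) t)
    (hδ : ∀ t ∈ Set.Icc (0 : ℝ) 1, HasDerivWithinAt δ (P (δ t)) (Set.Icc (0 : ℝ) 1) t)
    (h0 : γ 0 = δ 0) : Set.EqOn γ δ (Set.Icc 0 1) := by
  have cγ : ContinuousOn γ (Set.Icc 0 1) := fun t ht => (hγ t ht).continuousWithinAt
  have cδ : ContinuousOn δ (Set.Icc 0 1) := fun t ht => (hδ t ht).continuousWithinAt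
  have hK : IsCompact (γ '' Set.Icc 0 1 ∪ δ '' Set.Icc 0 1) :=
    (isCompact_Icc.image_of_continuousOn cγ).union (isCompact_Icc.image_of_continuousOn cδ)
  obtain ⟨K, hK⟩ := (hP.locallyLipschitzOn (s := γ '' Set.Icc 0 1 ∪ δ '' Set.Icc 0 1)
    ).exists_lipschitzOnWith_of_compact hK
  have hmem : ∀ t ∈ Set.Ico (0 : ℝ) 1, Set.Icc (0 : ℝ) 1 ∈ 𝓝[Set.Ici t] t := by
    intro t ht
    have : Set.Icc t 1 ∈ 𝓝[Set.Ici t] t := Icc_mem_nhdsGE ht.2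
    exact mem_of_superset this (Set.Icc_subset_Icc_left ht.1)
  refine ODE_solution_unique_of_mem_Icc_right (v := fun _ => P)
    (s := fun _ => γ '' Set.Icc 0 1 ∪ δ '' Set.Icc 0 1) (fun _ _ => hK) cγ
    (fun t ht => (hγ t (Set.Ico_subset_Icc_self ht)).mono_of_mem_nhdsWithin (hmem t ht))
    (fun t ht => Or.inl ⟨t, Set.Ico_subset_Icc_self ht, rfl⟩) cδ
    (fun t ht => (hδ t (Set.Ico_subset_Icc_self ht)).mono_of_mem_nhdsWithin (hmem t ht))
    (fun t ht => Or.inr ⟨t, Set.Ico_subset_Icc_self ht, rfl⟩) h0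

lemma locallyLipschitz_field (c : S × Sc × S) (κ : ℝ) :
    LocallyLipschitz (fun p => sField c p + κ • X0 p) := by
  refine ContDiff.locallyLipschitz (𝕂 := ℝ) (contDiff_iff_contDiffAt.2 fun p => ?_)
  exact (analyticOnNhd_field c κ p trivial).contDiffAt.restrict_scalars ℝ

/-- A field whose germ is polynomial is polynomial on its whole domain, so that its integral
curves are integral curves of the polynomial field. -/
lemma IsExp.exists_integralCurves {c : S × Sc × S} {κ : ℝ} {H : Germ (𝓝 (0 : Sc × Sc)) (Sc × Sc)}
    (h : IsExp (germ (sField c) + κ • germ X0) H) :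
    ∃ h : Sc × Sc → Sc × Sc, H = germ h ∧ ∀ᶠ p in 𝓝 (0 : Sc × Sc), ∃ γ : ℝ → Sc × Sc,
      γ 0 = p ∧ γ 1 = h p ∧ ∀ t ∈ Set.Icc (0 : ℝ) 1,
        HasDerivWithinAt γ (sField c (γ t) + κ • X0 (γ t)) (Set.Icc (0 : ℝ) 1) t := by
  obtain ⟨U, f, h, -, hUc, hU0, hf, hX, rfl, hev⟩ := h
  refine ⟨h, rfl, ?_⟩
  have hfe : (fun p => sField c p + κ • X0 p) =ᶠ[𝓝 0] f := Germ.coe_eq.1 hX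
  have heq := ((analyticOnNhd_field c κ).mono (Set.subset_univ U)).eqOn_of_preconnected_of_eventuallyEq
    hf hUc.isPreconnected hU0 hfe
  filter_upwards [hev] with p ⟨γ, h0, h1, hγ⟩
  refine ⟨γ, h0, h1, fun t ht => ?_⟩
  have := (hγ t ht).2
  rwa [← heq (hγ t ht).1] at this

lemma HasDerivWithinAt.star_Sc {b : ℝ → Sc} {b' : Sc} {s : Set ℝ} {t : ℝ}
    (h : HasDerivWithinAt b b' s t) : HasDerivWithinAt (fun t => star (b t)) (star b') s t :=
  h.star

/-- Ansatz: the flow is `G_{-4} ∘ G_0 ∘ G_4` with time-dependent parameters `ω`, `b`, `e`. With `φ =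
invSqrt (-(e w))` one has `φ' = C (b b̄)² w φ³`, which supplies the `Z W` and `W²` terms; reality of
`ω` enters through the derivative of `b̄`. -/
lemma hasDerivWithinAt_curve {A C : S} {B z w : Sc} {ω b e : ℝ → Sc} {s : Set ℝ} {t : ℝ}
    (hωs : star (ω t) = ω t)
    (hω : HasDerivWithinAt ω (ofS A + 2 * (B + star B) * ω t + 2 * ofS C * ω t ^ 2) s t)
    (hb : HasDerivWithinAt b (b t * (B + ofS C * ω t)) s t)
    (he : HasDerivWithinAt e (2 * ofS C * (b t * star (b t)) ^ 2) s t)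
    (hn : ‖-(e t * w)‖ < 1) :
    HasDerivWithinAt (fun t => (b t * (z * invSqrt (-(e t * w))),
      b t ^ 2 * star (b t) ^ 2 * (w * invSqrt (-(e t * w)) ^ 2) + ω t))
      (sField (A, B, C) (b t * (z * invSqrt (-(e t * w))),
      b t ^ 2 * star (b t) ^ 2 * (w * invSqrt (-(e t * w)) ^ 2) + ω t)) s t := by
  obtain ⟨L, hL, hLv⟩ := hasFDerivAt_invSqrt hn
  have hy : HasDerivWithinAt (fun t => -(e t * w)) (-(2 * ofS C * (b t * star (b t)) ^ 2 * w)) s t :=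
    (he.mul_const w).neg
  have hφ := hL.comp_hasDerivWithinAt t hy
  have hbs := HasDerivWithinAt.star_Sc hb
  rw [star_mul, star_add, star_mul, hωs, star_ofS] at hbs
  have h1 := hb.mul (hφ.const_mul z)
  have h2 := (((hb.pow 2).mul (hbs.pow 2)).mul ((hφ.pow 2).const_mul w)).add hω
  have hv : L (-(2 * ofS C * (b t * star (b t)) ^ 2 * w)) =
      ofS C * (b t * star (b t)) ^ 2 * w * invSqrt (-(e t * w)) ^ 3 := by
    have := hLv (-(2 * ofS C * (b t * star (b t)) ^ 2 * w))
    refine sub_eq_zero.1 (eq_zero_of_two_mul ?_)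
    linear_combination this
  rw [hv] at h1 h2
  refine (h1.prodMk h2).congr_deriv ?_
  simp only [sField, LinearMap.coe_mk, AddHom.coe_mk, Function.comp_apply]
  apply Prod.ext
  · simp only
    ring
  · simp
    ring

/-- Explicit integral curves of the `S`-holomorphic fields in `aut Q`. -/
lemma exists_explicit_curves {A C A₁ C₁ : S} {B B₁ : Sc} {ω b e : ℝ → Sc}
    (hωs : ∀ t ∈ Set.Icc (0 : ℝ) 1, star (ω t) = ω t)
    (hω : ∀ t ∈ Set.Icc (0 : ℝ) 1, HasDerivWithinAt ω
      (ofS A + 2 * (B + star B) * ω t + 2 * ofS C * ω t ^ 2) (Set.Icc 0 1) t)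
    (hb : ∀ t ∈ Set.Icc (0 : ℝ) 1, HasDerivWithinAt b (b t * (B + ofS C * ω t)) (Set.Icc 0 1) t)
    (he : ∀ t ∈ Set.Icc (0 : ℝ) 1, HasDerivWithinAt e
      (2 * ofS C * (b t * star (b t)) ^ 2) (Set.Icc 0 1) t)
    (hω0 : ω 0 = 0) (hb0 : b 0 = 1) (he0 : e 0 = 0)
    (hω1 : ofS A₁ = ω 1) (hb1 : B₁ = b 1) (he1 : ofS C₁ = e 1) :
    ∀ᶠ p in 𝓝 (0 : Sc × Sc), ∃ γ : ℝ → Sc × Sc, γ 0 = p ∧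
      γ 1 = (GNeg A₁ ∘ GZero B₁ ∘ GPos C₁) p ∧ ∀ t ∈ Set.Icc (0 : ℝ) 1,
        HasDerivWithinAt γ (sField (A, B, C) (γ t)) (Set.Icc (0 : ℝ) 1) t := by
  have hce : ContinuousOn e (Set.Icc 0 1) := fun t ht => (he t ht).continuousWithinAt
  obtain ⟨M, hM⟩ := isCompact_Icc.exists_bound_of_continuousOn hce
  have hsm : ∀ᶠ p in 𝓝 (0 : Sc × Sc), (|M| + 1) * ‖p.2‖ < 1 := by
    have : Continuous fun p : Sc × Sc => (|M| + 1) * ‖p.2‖ := by fun_prop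
    exact (this.tendsto' 0 0 (by simp)).eventually_lt_const one_pos
  filter_upwards [hsm] with p hp
  have hn : ∀ t ∈ Set.Icc (0 : ℝ) 1, ‖-(e t * p.2)‖ < 1 := by
    intro t ht
    rw [norm_neg]
    refine (norm_mul_le _ _).trans_lt (lt_of_le_of_lt ?_ hp)
    refine mul_le_mul_of_nonneg_right ?_ (norm_nonneg _)
    linarith [hM t ht, le_abs_self M]
  refine ⟨fun t => (b t * (p.1 * invSqrt (-(e t * p.2))),
      b t ^ 2 * star (b t) ^ 2 * (p.2 * invSqrt (-(e t * p.2)) ^ 2) + ω t), ?_, ?_, ?_⟩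
  · simp [hω0, hb0, he0, invSqrt_zero]
  · have h1 := hn 1 (by simp)
    rw [← he1] at h1
    rw [comp_apply h1, hω1, hb1, he1]
  · intro t ht
    exact hasDerivWithinAt_curve (hωs t ht) (hω t ht) (hb t ht) (he t ht) (hn t ht)

lemma isExp_sField {c : S × Sc × S} {h : Sc × Sc → Sc × Sc}
    (hc : ∀ᶠ p in 𝓝 (0 : Sc × Sc), ∃ γ : ℝ → Sc × Sc, γ 0 = p ∧
      γ 1 = h p ∧ ∀ t ∈ Set.Icc (0 : ℝ) 1,
        HasDerivWithinAt γ (sField c (γ t)) (Set.Icc (0 : ℝ) 1) t) :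
    IsExp (germ (sField c)) (germ h) := by
  refine ⟨Set.univ, sField c, h, isOpen_univ, isConnected_univ, trivial, analyticOnNhd_sField c,
    rfl, rfl, ?_⟩
  filter_upwards [hc] with p ⟨γ, h0, h1, h2⟩
  exact ⟨γ, h0, h1, fun t ht => ⟨trivial, h2 t ht⟩⟩

lemma exists_primitive {f : ℝ → Sc} (hf : Continuous f) : ∃ I : ℝ → Sc, I 0 = 0 ∧
    (∀ t, HasDerivAt I (f t) t) ∧ ((∀ t, star (f t) = f t) → ∀ t, star (I t) = I t) := by
  refine ⟨fun t => ∫ x in (0 : ℝ)..t, f x, by simp,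
    fun t => (hf.integral_hasStrictDerivAt 0 t).hasDerivAt, fun hs t => ?_⟩
  have := ((starL' ℝ : Sc ≃L[ℝ] Sc) : Sc →L[ℝ] Sc).intervalIntegral_comp_comm
    (hf.intervalIntegrable (μ := MeasureTheory.volume) 0 t)
  simp only [ContinuousLinearEquiv.coe_coe, starL'_apply, hs] at this
  exact this.symm

/-- As `Sc` is commutative, the exponential of a primitive solves the linear equation. -/
lemma exists_exponential {f : ℝ → Sc} (hf : Continuous f) : ∃ b : ℝ → Sc, b 0 = 1 ∧
    (∀ t, HasDerivAt b (b t * f t) t) ∧ (∀ t, IsUnit (b t)) := by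
  obtain ⟨I, h0, h1, -⟩ := exists_primitive hf
  refine ⟨fun t => NormedSpace.exp (I t), by simp [h0], fun t => ?_, fun t => ?_⟩
  · exact ((hasFDerivAt_exp (𝕂 := ℝ) (x := I t)).comp_hasDerivAt t (h1 t)).congr_deriv (by simp)
  · exact NormedSpace.isUnit_exp _

/-- A Riccati solution may blow up before time one. Its existence on `[0, 1]` comes from the
hypothesis, applied to the origin; the remaining equations are linear or quadratures. -/
theorem IsExp.eq_comp {c : S × Sc × S} {H : Germ (𝓝 (0 : Sc × Sc)) (Sc × Sc)}
    (h : IsExp (germ (sField c)) H) :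
    ∃ (A : S) (B : Sc) (C : S), IsUnit B ∧ H = germ (GNeg A ∘ GZero B ∘ GPos C) := by
  obtain ⟨A, B, C⟩ := c
  have h' : IsExp (germ (sField (A, B, C)) + (0 : ℝ) • germ X0) H := by simpa using h
  obtain ⟨h, rfl, hev⟩ := h'.exists_integralCurves
  have hlip := locallyLipschitz_field (A, B, C) 0
  simp only [zero_smul, add_zero] at hev hlip
  obtain ⟨γ, hγ0, -, hγ⟩ := hev.self_of_nhds
  set ω : ℝ → Sc := fun t => (γ t).2 with hωdef
  have hω : ∀ t ∈ Set.Icc (0 : ℝ) 1, HasDerivWithinAt ω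
      (ofS A + 2 * (B + star B) * ω t + 2 * ofS C * ω t ^ 2) (Set.Icc 0 1) t :=
    fun t ht => (hγ t ht).snd
  have hω0 : ω 0 = 0 := by simp [hωdef, hγ0]
  -- The set `Z = 0` is invariant, so uniqueness for the Riccati equation follows from uniqueness
  -- for the field. It gives reality of `ω`, since `star ω` solves the same equation.
  have hlift : ∀ v : ℝ → Sc, (∀ t ∈ Set.Icc (0 : ℝ) 1, HasDerivWithinAt v
      (ofS A + 2 * (B + star B) * v t + 2 * ofS C * v t ^ 2) (Set.Icc 0 1) t) →
      ∀ t ∈ Set.Icc (0 : ℝ) 1, HasDerivWithinAt (fun t => ((0, v t) : Sc × Sc))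
        (sField (A, B, C) (0, v t)) (Set.Icc 0 1) t := by
    intro v hv t ht
    refine ((hasDerivWithinAt_const t _ (0 : Sc)).prodMk (hv t ht)).congr_deriv ?_
    simp [sField]
  have h2 : star (2 : Sc) = 2 := star_ofNat 2
  have hωs : ∀ t ∈ Set.Icc (0 : ℝ) 1, star (ω t) = ω t := by
    have hs : ∀ t ∈ Set.Icc (0 : ℝ) 1, HasDerivWithinAt (fun t => star (ω t))
        (ofS A + 2 * (B + star B) * star (ω t) + 2 * ofS C * star (ω t) ^ 2) (Set.Icc 0 1) t := by
      intro t ht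
      refine (HasDerivWithinAt.star_Sc (hω t ht)).congr_deriv ?_
      simp only [star_add, star_mul, star_pow, star_star, star_ofS, h2]
      ring
    have := integralCurve_unique hlip (hlift _ hs) (hlift _ hω) (by simp [hω0])
    intro t ht
    exact congrArg Prod.snd (this ht)
  have hcω : ContinuousOn ω (Set.Icc 0 1) := fun t ht => (hω t ht).continuousWithinAt
  have hext : Continuous (Set.IccExtend (zero_le_one' ℝ) ((Set.Icc (0 : ℝ) 1).domRestrict ω)) :=
    hcω.domRestrict.Icc_extend'
  set ω' := Set.IccExtend (zero_le_one' ℝ) ((Set.Icc (0 : ℝ) 1).domRestrict ω) with hω'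
  have hωω : ∀ t ∈ Set.Icc (0 : ℝ) 1, ω' t = ω t := fun t ht => by
    rw [hω', Set.IccExtend_of_mem _ _ ht]; rfl
  obtain ⟨b, hb0, hb, hbu⟩ := exists_exponential (f := fun t => B + ofS C * ω' t) (by fun_prop)
  have hbc : Continuous b := continuous_iff_continuousAt.2 fun t => (hb t).continuousAt
  obtain ⟨e, he0, he, hes⟩ := exists_primitive (f := fun t => 2 * ofS C * (b t * star (b t)) ^ 2)
    (by fun_prop)
  obtain ⟨A₁, hA₁⟩ := exists_ofS (hωs 1 (by simp))
  obtain ⟨C₁, hC₁⟩ := exists_ofS (hes (fun t => by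
    simp only [star_mul, star_pow, star_star, star_ofS, h2]; ring) 1)
  refine ⟨A₁, b 1, C₁, hbu 1, Germ.coe_eq.2 ?_⟩
  have hcurve := exists_explicit_curves hωs hω (fun t ht => by
      have := (hb t).hasDerivWithinAt (s := Set.Icc 0 1)
      rwa [hωω t ht] at this) (fun t _ => (he t).hasDerivWithinAt) hω0 hb0 he0 hA₁ rfl hC₁
  filter_upwards [hev, hcurve] with p ⟨γ₁, k0, k1, hk⟩ ⟨γ₂, l0, l1, hl⟩
  rw [← k1, ← l1]
  exact integralCurve_unique hlip hk hl (k0.trans l0.symm) (by simp)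

/-- If the exponential of a field in `aut Q` is `S`-holomorphic, then so is the field. -/
theorem eq_zero_of_sHol {c : S × Sc × S} {κ : ℝ} {H : Germ (𝓝 (0 : Sc × Sc)) (Sc × Sc)}
    (hX : IsExp (germ (sField c) + κ • germ X0) H) (hH : SHol H) : κ = 0 := by
  obtain ⟨A, B, C⟩ := c
  obtain ⟨h, rfl, hev⟩ := hX.exists_integralCurves
  obtain ⟨c₀, c₁, hd, hn⟩ := ((sHol_germ_iff h).1 hH).1.exists_deriv
  obtain ⟨γ, hγ0, -, hγ⟩ := hev.self_of_nhds
  set ω : ℝ → Sc := fun t => (γ t).2 with hωdef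
  have hω : ∀ t ∈ Set.Icc (0 : ℝ) 1, HasDerivWithinAt ω
      (ofS A + 2 * (B + star B) * ω t + 2 * ofS C * ω t ^ 2 + κ • mkSc 0 (ω t).snd)
      (Set.Icc 0 1) t := fun t ht => (hγ t ht).snd
  have hω0 : ω 0 = 0 := by simp [hωdef, hγ0]
  have hcω : ContinuousOn ω (Set.Icc 0 1) := fun t ht => (hω t ht).continuousWithinAt
  have hext : Continuous (Set.IccExtend (zero_le_one' ℝ) ((Set.Icc (0 : ℝ) 1).domRestrict ω)) :=
    hcω.domRestrict.Icc_extend'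
  set ω' := Set.IccExtend (zero_le_one' ℝ) ((Set.Icc (0 : ℝ) 1).domRestrict ω) with hω'
  have hωω : ∀ t ∈ Set.Icc (0 : ℝ) 1, ω' t = ω t := fun t ht => by
    rw [hω', Set.IccExtend_of_mem _ _ ht]; rfl
  obtain ⟨b, hb0, hb', hbu⟩ := exists_exponential (f := fun t => B + ofS C * ω' t) (by fun_prop)
  have hb : ∀ t ∈ Set.Icc (0 : ℝ) 1,
      HasDerivWithinAt b (b t * (B + ofS C * ω t)) (Set.Icc 0 1) t := by
    intro t ht
    have := (hb' t).hasDerivWithinAt (s := Set.Icc 0 1)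
    rwa [hωω t ht] at this
  have ht : ∀ d : Sc, Tendsto (fun ε : ℂ => ((ε • d, 0) : Sc × Sc)) (𝓝 0) (𝓝 0) := by
    intro d
    have : Continuous fun ε : ℂ => ((ε • d, 0) : Sc × Sc) := by fun_prop
    exact this.tendsto' 0 0 (by simp)
  -- On `Z ∈ ℂn` the field `κ X0` multiplies the first component by `κ`, which contributes the
  -- factor `e^(κt)`.
  have hnil : ∀ᶠ ε : ℂ in 𝓝 0, (h (ε • nS, 0)).1 = Real.exp κ • ε • (nS * b 1) := by
    filter_upwards [(ht nS).eventually hev] with ε ⟨δ, hδ0, hδ1, hδ⟩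
    have hcurve : ∀ t ∈ Set.Icc (0 : ℝ) 1, HasDerivWithinAt
        (fun t => ((Real.exp (κ * t) • ε • (nS * b t), ω t) : Sc × Sc))
        (sField (A, B, C) (Real.exp (κ * t) • ε • (nS * b t), ω t) +
          κ • X0 (Real.exp (κ * t) • ε • (nS * b t), ω t)) (Set.Icc 0 1) t := by
      intro t ht
      have h1 : HasDerivWithinAt (fun t => Real.exp (κ * t)) (Real.exp (κ * t) * κ)
          (Set.Icc 0 1) t := by
        simpa using (((hasDerivAt_id t).const_mul κ).exp).hasDerivWithinAt
      have h2 := h1.smul (((hb t ht).const_mul nS).const_smul ε)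
      refine (h2.prodMk (hω t ht)).congr_deriv ?_
      apply Prod.ext
      · apply Sc.ext
        · simp [sField, X0]
        · simp [sField, X0]
          ring
      · simp [sField, X0]
    have := integralCurve_unique (locallyLipschitz_field (A, B, C) κ) hδ hcurve
      (by simp [hδ0, hb0, hω0]) (Set.right_mem_Icc.2 zero_le_one)
    rw [← hδ1, this]
    simp
  -- The components without `n` form a closed system that does not involve `κ`.
  have hone : ∀ᶠ ε : ℂ in 𝓝 0, (h (ε • 1, 0)).1.fst = ε * (b 1).fst := by
    filter_upwards [(ht 1).eventually hev] with ε ⟨δ, hδ0, hδ1, hδ⟩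
    let P : ℂ × ℂ → ℂ × ℂ := fun p => (p.1 * (B.fst + C.fst * p.2),
      A.fst + 2 * (B.fst + star B.fst) * p.2 + 2 * C.fst * p.2 ^ 2)
    have hP : LocallyLipschitz P := by
      refine ContDiff.locallyLipschitz (𝕂 := ℝ) ?_
      fun_prop
    have hfst : ∀ (v : ℝ → Sc) (v' : Sc) (t : ℝ), HasDerivWithinAt v v' (Set.Icc 0 1) t →
        HasDerivWithinAt (fun t => (v t).fst) v'.fst (Set.Icc 0 1) t := by
      intro v v' t hv
      exact (((TrivSqZeroExt.fstCLM ℂ ℂ : Sc →L[ℂ] ℂ).restrictScalars ℝ).hasFDerivAt.comp_hasDerivWithinAt t hv)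
    have k1 : ∀ t ∈ Set.Icc (0 : ℝ) 1, HasDerivWithinAt
        (fun t => (((δ t).1.fst, (δ t).2.fst) : ℂ × ℂ)) (P ((δ t).1.fst, (δ t).2.fst))
        (Set.Icc 0 1) t := by
      intro t ht
      refine ((hfst _ _ t (hδ t ht).fst).prodMk (hfst _ _ t (hδ t ht).snd)).congr_deriv ?_
      simp [sField, X0, P, fst_two]
    have k2 : ∀ t ∈ Set.Icc (0 : ℝ) 1, HasDerivWithinAt
        (fun t => ((ε * (b t).fst, (ω t).fst) : ℂ × ℂ)) (P (ε * (b t).fst, (ω t).fst))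
        (Set.Icc 0 1) t := by
      intro t ht
      refine (((hfst _ _ t (hb t ht)).const_mul ε).prodMk (hfst _ _ t (hω t ht))).congr_deriv ?_
      simp [P, fst_two, mul_assoc]
    have := integralCurve_unique hP k1 k2 (by simp [hδ0, hb0, hω0])
      (Set.right_mem_Icc.2 zero_le_one)
    rw [← hδ1]
    exact congrArg Prod.fst this
  have e1 : c₁.fst = (b 1).fst := by
    have h1 : HasDerivAt (fun ε : ℂ => (h (ε • 1, 0)).1.fst) c₁.fst 0 :=
      (TrivSqZeroExt.fstCLM ℂ ℂ : Sc →L[ℂ] ℂ).hasFDerivAt.comp_hasDerivAt 0 hd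
    have h2 : HasDerivAt (fun ε : ℂ => ε * (b 1).fst) (b 1).fst 0 := by
      simpa using (hasDerivAt_id (0 : ℂ)).mul_const (b 1).fst
    exact (h1.congr_of_eventuallyEq (EventuallyEq.symm hone)).unique h2
  have hb1 : (b 1).fst ≠ 0 := by
    have := TrivSqZeroExt.isUnit_iff_isUnit_fst.1 (hbu 1)
    exact this.ne_zero
  have e2 := hn.and hnil
  obtain ⟨ε, hε, hε0⟩ := ((e2.filter_mono nhdsWithin_le_nhds).and
    (self_mem_nhdsWithin (a := (0 : ℂ)) (s := {0}ᶜ))).exists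
  have e3 := e2.self_of_nhds
  have e4 := congrArg TrivSqZeroExt.snd (hε.1.symm.trans hε.2)
  have e5 := congrArg TrivSqZeroExt.snd (e3.1.symm.trans e3.2)
  simp at e4 e5
  rw [e5, zero_add, e1] at e4
  have e6 : (ε * (b 1).fst) * ((Real.exp κ : ℂ) - 1) = 0 := by
    push_cast
    linear_combination -e4
  have e7 := (mul_eq_zero.1 e6).resolve_left (mul_ne_zero hε0 hb1)
  -- Matching derivatives along `1` and `n` yields `e^κ = 1`; `κ` is real, so no periods occur.
  have e8 : Real.exp κ = 1 := by exact_mod_cast sub_eq_zero.1 e7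
  exact Real.exp_eq_one_iff κ |>.1 e8

/-! ### Coordinates of `Q` and the flow of `X0` -/

lemma mkSc_mem_Q_iff (z₁ z₂ w₁ w₂ : ℂ) : (mkSc z₁ z₂, mkSc w₁ w₂) ∈ Q ↔
    w₁.im = ‖z₁‖ ^ 4 ∧ w₂.im = 4 * (z₁ ^ 2 * star z₁ * star z₂).re := by
  have h1 : z₁ ^ 2 * (starRingEnd ℂ) z₁ ^ 2 = ((‖z₁‖ ^ 4 : ℝ) : ℂ) := by
    rw [← mul_pow, Complex.mul_conj, Complex.normSq_eq_norm_sq]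
    push_cast
    ring
  have h2 : z₁ ^ 2 * (2 * ((starRingEnd ℂ) z₁ * (starRingEnd ℂ) z₂)) +
      2 * (z₁ * z₂) * (starRingEnd ℂ) z₁ ^ 2 =
        ((4 * (z₁ ^ 2 * star z₁ * star z₂).re : ℝ) : ℂ) := by
    have := Complex.add_conj (z₁ ^ 2 * star z₁ * star z₂)
    simp only [map_mul, map_pow, Complex.star_def, Complex.conj_conj] at this
    simp only [Complex.star_def]
    push_cast at this ⊢
    linear_combination 2 * this
  have h3 : rho (mkSc z₁ z₂, mkSc w₁ w₂) = mkSc ((w₁.im : ℂ) - ((‖z₁‖ ^ 4 : ℝ) : ℂ))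
      ((w₂.im : ℂ) - ((4 * (z₁ ^ 2 * star z₁ * star z₂).re : ℝ) : ℂ)) := by
    rw [← h1, ← h2]
    apply Sc.ext
    · simp [rho]
    · simp [rho, pow_two]
      ring
  have h4 : ∀ a b : ℂ, mkSc a b = 0 ↔ a = 0 ∧ b = 0 := by
    intro a b
    constructor
    · intro h
      exact ⟨by simpa using congrArg TrivSqZeroExt.fst h, by simpa using congrArg TrivSqZeroExt.snd h⟩
    · rintro ⟨rfl, rfl⟩
      apply Sc.ext <;> simp
  rw [Q, Set.mem_ofPred_eq, h3, h4, sub_eq_zero, sub_eq_zero, Complex.ofReal_inj,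
    Complex.ofReal_inj]

lemma flow_zero : flow 0 = id := by
  funext p
  simp [flow]

lemma flow_add (s t : ℝ) : flow (s + t) = flow s ∘ flow t := by
  funext p
  simp [flow, Complex.exp_add, mul_assoc]

lemma hasDerivAt_flow (p : Sc × Sc) (t : ℝ) :
    HasDerivAt (fun s => flow s p) (X0 (flow t p)) t := by
  have h1 : HasDerivAt (fun s : ℝ => Complex.exp s) (Complex.exp t) t := by
    simpa using (Complex.hasDerivAt_exp t).comp_ofReal
  have h2 : ∀ Z : Sc, HasDerivAt (fun s : ℝ => mkSc Z.fst (Complex.exp s * Z.snd))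
      (mkSc 0 (Complex.exp t * Z.snd)) t := by
    intro Z
    have h3 := ((TrivSqZeroExt.inrCLM ℂ ℂ : ℂ →L[ℂ] Sc).restrictScalars ℝ).hasFDerivAt.comp_hasDerivAt t
      (h1.mul_const Z.snd)
    refine (h3.const_add (TrivSqZeroExt.inl Z.fst)).congr_deriv ?_
    apply Sc.ext <;> simp
  refine ((h2 p.1).prodMk (h2 p.2)).congr_deriv ?_
  simp [X0, flow]

lemma differentiable_flow (t : ℝ) : Differentiable ℂ (flow t) := by
  have h2 : Differentiable ℂ fun Z : Sc => mkSc Z.fst (Complex.exp t * Z.snd) := by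
    refine Differentiable.add ?_ ?_
    · exact ((TrivSqZeroExt.inlCLM ℂ ℂ).comp (TrivSqZeroExt.fstCLM ℂ ℂ) : Sc →L[ℂ] Sc).differentiable
    · exact ((TrivSqZeroExt.inrCLM ℂ ℂ : ℂ →L[ℂ] Sc).differentiable).comp
        ((TrivSqZeroExt.sndCLM ℂ ℂ : Sc →L[ℂ] ℂ).differentiable.const_mul _)
  exact (h2.comp differentiable_fst).prodMk (h2.comp differentiable_snd)

lemma flow_mem_Q {t : ℝ} {p : Sc × Sc} (hp : p ∈ Q) : flow t p ∈ Q := by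
  obtain ⟨Z, W⟩ := p
  rw [← mkSc_fst_snd Z, ← mkSc_fst_snd W, mkSc_mem_Q_iff] at hp
  rw [flow, mkSc_mem_Q_iff]
  refine ⟨hp.1, ?_⟩
  have h : Z.fst ^ 2 * star Z.fst * star ((Real.exp t : ℂ) * Z.snd) =
      (Real.exp t : ℂ) * (Z.fst ^ 2 * star Z.fst * star Z.snd) := by
    simp only [star_mul', Complex.star_def, Complex.conj_ofReal]
    ring
  rw [← Complex.ofReal_exp, h, Complex.im_ofReal_mul, Complex.re_ofReal_mul, hp.2]
  ring

lemma flow_image_Q (t : ℝ) : flow t '' Q = Q := by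
  apply Set.Subset.antisymm
  · rintro _ ⟨p, hp, rfl⟩
    exact flow_mem_Q hp
  · intro p hp
    refine ⟨flow (-t) p, flow_mem_Q hp, ?_⟩
    rw [← Function.comp_apply (f := flow t), ← flow_add, add_neg_cancel, flow_zero, id]

lemma isExp_flow (t : ℝ) : IsExp (t • germ X0) (germ (flow t)) := by
  refine ⟨Set.univ, t • X0, flow t, isOpen_univ, isConnected_univ, trivial, ?_, rfl, rfl, ?_⟩
  · have := analyticOnNhd_field 0 t
    simpa [Pi.smul_def] using this
  · refine Eventually.of_forall fun p => ⟨fun s => flow (s * t) p, ?_, ?_, fun s _ => ⟨trivial, ?_⟩⟩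
    · simp [flow_zero]
    · simp
    · have h := (hasDerivAt_flow p (s * t)).scomp s ((hasDerivAt_id s).mul_const t)
      exact h.hasDerivWithinAt.congr_deriv (by simp)

/-! ### The basic maps and the `S`-holomorphic local group -/

/-- Germs of the basic maps as compositions. -/
lemma germ_comp_eq {A C : S} {B : Sc} {h : Sc × Sc → Sc × Sc}
    (hh : ∀ p : Sc × Sc, ‖-(ofS C * p.2)‖ < 1 → h p = (B * (p.1 * invSqrt (-(ofS C * p.2))),
      B ^ 2 * star B ^ 2 * (p.2 * invSqrt (-(ofS C * p.2)) ^ 2) + ofS A)) :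
    germ (GNeg A ∘ GZero B ∘ GPos C) = germ h := by
  refine Germ.coe_eq.2 ?_
  filter_upwards [eventually_norm_mul_lt (ofS C)] with p hp
  rw [comp_apply hp, hh p hp]

lemma comp_mem_AutSLoc {c : S × Sc × S} {A C : S} {B : Sc}
    (h : IsExp (germ (sField c)) (germ (GNeg A ∘ GZero B ∘ GPos C))) :
    germ (GNeg A ∘ GZero B ∘ GPos C) ∈ AutSLoc :=
  ⟨⟨_, sField_mem_aut c, h⟩, sHol_comp A C B⟩

@[simp] lemma ofS_zero : ofS 0 = 0 := by apply Sc.ext <;> simp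

lemma GNeg_mem (A : S) : germ (GNeg A) ∈ AutSLoc := by
  have h := comp_mem_AutSLoc (c := (A, 0, 0)) (A := A) (C := 0) (B := 1) (isExp_sField
    (exists_explicit_curves (ω := fun t => t • ofS A) (b := fun _ => 1) (e := fun _ => 0)
      (fun t _ => by simp [star_smul]) (fun t _ => by
        refine ((hasDerivAt_id t).smul_const (ofS A)).hasDerivWithinAt.congr_deriv ?_
        simp)
      (fun t _ => (hasDerivWithinAt_const _ _ _).congr_deriv (by simp))
      (fun t _ => (hasDerivWithinAt_const _ _ _).congr_deriv (by simp))
      (by simp) rfl rfl (by simp) rfl (by simp)))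
  rwa [germ_comp_eq (h := GNeg A) (fun p hp => by simp [GNeg, invSqrt_zero])] at h

lemma GPos_mem (C : S) : germ (GPos C) ∈ AutSLoc := by
  -- The parameter `e` grows at rate `2C`, hence the half.
  have hC : 2 * ofS ((1 / 2 : ℝ) • C) = ofS C := by
    apply Sc.ext <;> simp [fst_two, snd_two]
  have h := comp_mem_AutSLoc (c := (0, 0, (1 / 2 : ℝ) • C)) (A := 0) (C := C) (B := 1) (isExp_sField
    (exists_explicit_curves (ω := fun _ => 0) (b := fun _ => 1) (e := fun t => t • ofS C)
      (fun t _ => by simp)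
      (fun t _ => (hasDerivWithinAt_const _ _ _).congr_deriv (by simp))
      (fun t _ => (hasDerivWithinAt_const _ _ _).congr_deriv (by simp))
      (fun t _ => by
        refine ((hasDerivAt_id t).smul_const (ofS C)).hasDerivWithinAt.congr_deriv ?_
        rw [hC]
        simp)
      rfl rfl (by simp) (by simp) rfl (by simp)))
  rwa [germ_comp_eq (h := GPos C) (fun p hp => by
    have := one_add_inv hp
    rw [← sub_eq_add_neg] at this
    simp only [GPos, this, ofS_zero]
    simp [invSqrt])] at h

lemma exists_exp_eq {B : Sc} (hB : IsUnit B) : ∃ β : Sc, NormedSpace.exp β = B := by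
  have h0 : B.fst ≠ 0 := (TrivSqZeroExt.isUnit_iff_isUnit_fst.1 hB).ne_zero
  -- The logarithm: `exp (x + yn) = e^x (1 + yn)`.
  refine ⟨mkSc (Complex.log B.fst) (B.snd / B.fst), ?_⟩
  rw [TrivSqZeroExt.exp_def]
  have : NormedSpace.exp (Complex.log B.fst) = B.fst := by
    rw [← Complex.exp_eq_exp_ℂ, Complex.exp_log h0]
  apply Sc.ext
  · simp [this]
  · simp [this]
    field_simp

lemma GZero_mem {B : Sc} (hB : IsUnit B) : germ (GZero B) ∈ AutSLoc := by
  obtain ⟨β, rfl⟩ := exists_exp_eq hB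
  have h := comp_mem_AutSLoc (c := (0, β, 0)) (A := 0) (C := 0) (B := NormedSpace.exp β)
    (isExp_sField (exists_explicit_curves (ω := fun _ => 0)
      (b := fun t : ℝ => NormedSpace.exp (t • β)) (e := fun _ => 0)
      (fun t _ => by simp)
      (fun t _ => (hasDerivWithinAt_const _ _ _).congr_deriv (by simp))
      (fun t _ => (hasDerivAt_exp_smul_const β t).hasDerivWithinAt.congr_deriv (by simp))
      (fun t _ => (hasDerivWithinAt_const _ _ _).congr_deriv (by simp))
      rfl (by simp) rfl (by simp) (by simp) (by simp)))
  rwa [germ_comp_eq (h := GZero (NormedSpace.exp β)) (fun p hp => by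
    simp [GZero, invSqrt_zero, star_eq_conjS])] at h

lemma AutSLoc_eq : AutSLoc = {H | ∃ X ∈ autS, IsExp X H} := by
  ext H
  constructor
  · rintro ⟨⟨X, hX, h⟩, hH⟩
    obtain ⟨c, κ, rfl⟩ := (mem_aut_iff X).1 hX
    have hκ := eq_zero_of_sHol h hH
    refine ⟨_, ?_, h⟩
    rw [hκ, zero_smul, add_zero]
    exact sField_mem_autS c
  · rintro ⟨X, hX, h⟩
    refine ⟨⟨X, hX.1, h⟩, ?_⟩
    obtain ⟨c, rfl⟩ := (mem_autS_iff X).1 hX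
    obtain ⟨A, B, C, -, rfl⟩ := h.eq_comp
    exact sHol_comp A C B

lemma mem_AutSLoc_iff {H : Germ (𝓝 (0 : Sc × Sc)) (Sc × Sc)} (hH : H ∈ AutLoc rho) :
    H ∈ AutSLoc ↔ ∃ (A : S) (B : Sc) (C : S), IsUnit B ∧
      H = germ (GNeg A ∘ GZero B ∘ GPos C) := by
  constructor
  · intro h
    rw [AutSLoc_eq] at h
    obtain ⟨X, hX, h⟩ := h
    obtain ⟨c, rfl⟩ := (mem_autS_iff X).1 hX
    exact h.eq_comp
  · rintro ⟨A, B, C, -, rfl⟩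
    exact ⟨hH, sHol_comp A C B⟩

end AlgCR

end

theorem mainTheorem3 :
    -- the surface in coordinates of `ℂ⁴`
    (∀ z₁ z₂ w₁ w₂ : ℂ, (AlgCR.mkSc z₁ z₂, AlgCR.mkSc w₁ w₂) ∈ AlgCR.Q ↔
      w₁.im = ‖z₁‖ ^ 4 ∧ w₂.im = 4 * (z₁ ^ 2 * star z₁ * star z₂).re) ∧
    -- `aut Q` is `aut_S Q` plus the line spanned by the additional field
    FiniteDimensional ℝ (AlgCR.aut AlgCR.rho) ∧
    Module.finrank ℝ (AlgCR.aut AlgCR.rho) = Module.finrank ℝ AlgCR.autS + 1 ∧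
    AlgCR.autS ⊔ Submodule.span ℝ {AlgCR.germ AlgCR.X0} = AlgCR.aut AlgCR.rho ∧
    AlgCR.autS ⊓ Submodule.span ℝ {AlgCR.germ AlgCR.X0} = ⊥ ∧
    -- the one-parameter group of the additional field
    (∀ t : ℝ, AlgCR.IsExp (t • AlgCR.germ AlgCR.X0) (AlgCR.germ (AlgCR.flow t))) ∧
    (∀ p : AlgCR.Sc × AlgCR.Sc, ∀ t : ℝ,
      HasDerivAt (fun s => AlgCR.flow s p) (AlgCR.X0 (AlgCR.flow t p)) t) ∧
    AlgCR.flow 0 = id ∧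
    (∀ s t : ℝ, AlgCR.flow (s + t) = AlgCR.flow s ∘ AlgCR.flow t) ∧
    (∀ t : ℝ, Differentiable ℂ (AlgCR.flow t) ∧ AlgCR.flow t '' AlgCR.Q = AlgCR.Q) ∧
    -- the `S`-holomorphic part of the local group
    AlgCR.AutSLoc = {H | ∃ X ∈ AlgCR.autS, AlgCR.IsExp X H} ∧
    (∀ A : AlgCR.S, AlgCR.germ (AlgCR.GNeg A) ∈ AlgCR.AutSLoc) ∧
    (∀ B : AlgCR.Sc, IsUnit B → AlgCR.germ (AlgCR.GZero B) ∈ AlgCR.AutSLoc) ∧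
    (∀ C : AlgCR.S, AlgCR.germ (AlgCR.GPos C) ∈ AlgCR.AutSLoc) ∧
    (∀ H ∈ AlgCR.AutLoc AlgCR.rho, H ∈ AlgCR.AutSLoc ↔
      ∃ (A : AlgCR.S) (B : AlgCR.Sc) (C : AlgCR.S), IsUnit B ∧
        H = AlgCR.germ (AlgCR.GNeg A ∘ AlgCR.GZero B ∘ AlgCR.GPos C)) := by
  exact ⟨AlgCR.mkSc_mem_Q_iff, AlgCR.finiteDimensional_aut, AlgCR.finrank_aut, AlgCR.autS_sup,
    AlgCR.autS_inf, AlgCR.isExp_flow, AlgCR.hasDerivAt_flow, AlgCR.flow_zero, AlgCR.flow_add,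
    fun t => ⟨AlgCR.differentiable_flow t, AlgCR.flow_image_Q t⟩, AlgCR.AutSLoc_eq,
    AlgCR.GNeg_mem, fun _ => AlgCR.GZero_mem, AlgCR.GPos_mem, fun _ => AlgCR.mem_AutSLoc_iff⟩
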